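/- Let $n\ge 1$. A Young function is a convex, left-continuous $\Phi:[0,\infty]\to[0,\infty]$ with $\lim_{r\to 0+}\Phi(r)=\Phi(0)=0$ and $\lim_{r\to\infty}\Phi(r)=\Phi(\infty)=\infty$; put $\Phi^{-1}(s)=\inf\{r\ge 0:\Phi(r)>s\}$ for $0\le s\le\infty$, where $\inf\emptyset=\infty$. Write $\Phi\in\nabla_2$ if, for some $C>1$, $\Phi(r)\le\frac1{2C}\Phi(Cr)$ for all $r\ge0$. The space $L^\Phi(\mathbb R^n)$ consists of the $f\in L^1_{\rm loc}(\mathbb R^n)$ with $\int\Phi(k|f|)\,dx<\infty$ for some $k>0$, and $$\|f\|_{L^\Phi}=\inf\Big\{\lambda>0:\int_{\mathbb R^n}\Phi\Big(\frac{|f(x)|}{\lambda}\Big)dx\le1\Big\},\qquad \|f\|_{{\rm W}L^\Phi}=\sup_{\lambda>0}\|\lambda\chi_{\{|f|>\lambda\}}\|_{L^\Phi};$$ ${\rm W}L^\Phi(\mathbb R^n)$ is the set of measurable $f$ with $\|f\|_{{\rm W}L^\Phi}<\infty$. Put $\|f\|_{L^\Phi(\Omega)}=\|f\chi_\Omega\|_{L^\Phi}$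 and likewise for ${\rm W}L^\Phi$. For $\varphi:(0,\infty)\to(0,\infty)$ the generalized Orlicz--Morrey space $\mathcal M^{\Phi,\varphi}(\mathbb R^n)$ (of the third kind) consists of the measurable $f$ with $f\chi_B\in L^\Phi(\mathbb R^n)$ for all balls $B$ and $$\|f\|_{\mathcal M^{\Phi,\varphi}}=\sup_{x\in\mathbb R^n,\,r>0}\varphi(r)^{-1}\Phi^{-1}(r^{-n})\|f\|_{L^\Phi(B(x,r))}<\infty;$$ ${\rm W}\mathcal M^{\Phi,\varphi}(\mathbb R^n)$ and its quasi-norm are defined in the same way with ${\rm W}L^\Phi$ in place of $L^\Phi$, and ${\rm W}\mathcal M^{1,\varphi}$ means ${\rm W}\mathcal M^{\Phi,\varphi}$ for $\Phi(t)=t$. A function $F:(0,\infty)\to(0,\infty)$ is almost increasing (almost decreasing) if, for some $C>0$, $F(r)\le CF(s)$ (respectively $F(r)\ge CF(s)$) whenever $r\le s$. Let $\mathcal G_\Phi$ be the set of $\varphi:(0,\infty)\to(0,\infty)$ such that $t\mapsto\varphi(t)/\Phi^{-1}(t^{-n})$ is almost increasing and $t\mapsto\varphi(t)/(\Phi^{-1}(t^{-n})t^n)$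 is almost decreasing. For $\rho:(0,\infty)\to(0,\infty)$ let $$M_\rho f(x)=\sup_{r>0}\frac{\rho(r)}{|B(x,r)|}\int_{B(x,r)}|f(y)|\,dy.$$ An operator $T$ is bounded from $X$ to $Y$ if there is a finite constant $C$ such that $Tf\in Y$ and $\|Tf\|_Y\le C\|f\|_X$ for all $f\in X$. **Theorem.** Let $\Phi,\Psi$ be Young functions, $\varphi_1\in\mathcal G_\Phi$, $\varphi_2\in\mathcal G_\Psi$ and $\rho:(0,\infty)\to(0,\infty)$. Consider the following conditions, each required for all $r>0$ with a finite constant $C$ independent of $r$: $$\text{(a)}\ \ \rho(r)\le C\,\frac{\Psi^{-1}(r^{-n})}{\Phi^{-1}(r^{-n})},\qquad \text{(b)}\ \ \frac{\varphi_1(r)}{\Phi^{-1}(r^{-n})}\le C\,\frac{\varphi_2(r)}{\Psi^{-1}(r^{-n})},$$ $$\text{(c)}\ \ \sup_{r<t<\infty}\varphi_1(t)\rho(t)\le C\varphi_2(r),\qquad \text{(d)}\ \ \varphi_1(r)\rho(r)\le C\varphi_2(r).$$ 1. Assume that $\rho$ is increasing, that $r\mapsto r^{-n}\rho(r)$ is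 decreasing (both in the non-strict sense), and that (a) and (b) hold. Then (c) is sufficient for the boundedness of $M_\rho$ from $\mathcal M^{\Phi,\varphi_1}(\mathbb R^n)$ to ${\rm W}\mathcal M^{\Psi,\varphi_2}(\mathbb R^n)$. If moreover $\Phi\in\nabla_2$, then (c) is sufficient for the boundedness of $M_\rho$ from $\mathcal M^{\Phi,\varphi_1}(\mathbb R^n)$ to $\mathcal M^{\Psi,\varphi_2}(\mathbb R^n)$. 2. Let $\varphi_1$ be almost decreasing. Then (d) is necessary for the boundedness of $M_\rho$ from $\mathcal M^{\Phi,\varphi_1}(\mathbb R^n)$ to ${\rm W}\mathcal M^{1,\varphi_2}(\mathbb R^n)$, and also for its boundedness from $\mathcal M^{\Phi,\varphi_1}(\mathbb R^n)$ to $\mathcal M^{\Psi,\varphi_2}(\mathbb R^n)$. 3. Assume that $\rho$ is increasing, that $r\mapsto r^{-n}\rho(r)$ is decreasing, that (a) and (b) hold, and that $\varphi_1$ and $\varphi_2$ are almost decreasing. Then (d) is necessary and sufficient for the boundedness of $M_\rho$ from $\mathcal M^{\Phi,\varphi_1}(\mathbb R^n)$ to ${\rm W}\mathcal M^{\Psi,\varphi_2}(\mathbb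 R^n)$. If moreover $\Phi\in\nabla_2$, then (d) is necessary and sufficient for the boundedness of $M_\rho$ from $\mathcal M^{\Phi,\varphi_1}(\mathbb R^n)$ to $\mathcal M^{\Psi,\varphi_2}(\mathbb R^n)$. -/

import Mathlib

open MeasureTheory Set Filter Topology
open scoped NNReal ENNReal

noncomputable section

namespace OrliczMorrey

/-- Young functions `[0,∞] → [0,∞]`: convex, left-continuous, `lim_{r → 0+} Φ(r) = Φ(0) = 0` and
`lim_{r → ∞} Φ(r) = Φ(∞) = ∞`. -/
structure IsYoung (Φ : ℝ≥0∞ → ℝ≥0∞) : Prop where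
  convex : ConvexOn ℝ≥0 univ Φ
  leftCont : ∀ t, 0 < t → ContinuousWithinAt Φ (Iic t) t
  map_zero : Φ 0 = 0
  tendsto_zero : Tendsto Φ (𝓝[>] 0) (𝓝 0)
  map_top : Φ ∞ = ∞
  tendsto_top : Tendsto Φ (𝓝[<] ∞) (𝓝 ∞)

/-- The generalized inverse `Φ⁻¹(s) = inf {r ≥ 0 : Φ(r) > s}`, with `inf ∅ = ∞`. -/
def youngInv (Φ : ℝ≥0∞ → ℝ≥0∞) (s : ℝ≥0∞) : ℝ≥0∞ := sInf {r | s < Φ r}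

/-- The `∇₂`-condition: for some finite `C > 1`, `Φ(r) ≤ Φ(C r) / (2 C)` for all `r ∈ [0,∞)`. -/
def Nabla2 (Φ : ℝ≥0∞ → ℝ≥0∞) : Prop :=
  ∃ C : ℝ≥0, 1 < C ∧ ∀ r : ℝ≥0, Φ r ≤ (2 * (C : ℝ≥0∞))⁻¹ * Φ (C * r)

/-- Almost increasing functions on `(0,∞)`; values at `0` are irrelevant. -/
def AlmostIncreasing (F : ℝ≥0 → ℝ≥0∞) : Prop :=
  ∃ C : ℝ≥0, 0 < C ∧ ∀ r s : ℝ≥0, 0 < r → r ≤ s → F r ≤ C * F s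

/-- Almost decreasing functions on `(0,∞)`; values at `0` are irrelevant. -/
def AlmostDecreasing (F : ℝ≥0 → ℝ≥0∞) : Prop :=
  ∃ C : ℝ≥0, 0 < C ∧ ∀ r s : ℝ≥0, 0 < r → r ≤ s → C * F s ≤ F r

/-- `Φ⁻¹(r⁻ⁿ)`. -/
def invScale (n : ℕ) (Φ : ℝ≥0∞ → ℝ≥0∞) (r : ℝ≥0) : ℝ≥0∞ := youngInv Φ (((r : ℝ≥0∞) ^ n)⁻¹)

/-- The class `𝒢_Φ` of functions `φ : (0,∞) → (0,∞)`: `φ(t) / Φ⁻¹(t⁻ⁿ)` is almost increasing and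
`φ(t) / (Φ⁻¹(t⁻ⁿ) tⁿ)` is almost decreasing. -/
structure GClass (n : ℕ) (Φ : ℝ≥0∞ → ℝ≥0∞) (φ : ℝ≥0 → ℝ≥0) : Prop where
  pos : ∀ r, 0 < r → 0 < φ r
  almostIncreasing : AlmostIncreasing fun t => (φ t : ℝ≥0∞) / invScale n Φ t
  almostDecreasing :
    AlmostDecreasing fun t => (φ t : ℝ≥0∞) / (invScale n Φ t * (t : ℝ≥0∞) ^ n)

section Spaces

/-! Functions take values in any `ε` with an extended norm, so that the definitions apply both to
scalar functions and to `[0,∞]`-valued ones such as maximal functions. -/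

variable {n : ℕ} {ε : Type*} [TopologicalSpace ε] [ESeminormedAddMonoid ε]

/-- The Luxemburg-Nakano norm of `L^Φ(ℝⁿ)` (equal to `∞` outside the space). -/
def luxNorm (Φ : ℝ≥0∞ → ℝ≥0∞) (f : EuclideanSpace ℝ (Fin n) → ε) : ℝ≥0∞ :=
  ⨅ (c : ℝ≥0) (_ : 0 < c) (_ : ∫⁻ x, Φ (‖f x‖ₑ / c) ≤ 1), (c : ℝ≥0∞)

/-- The weak Orlicz quasi-norm `sup_{c > 0} ‖c χ_{|f| > c}‖_{L^Φ}`. -/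
def weakLuxNorm (Φ : ℝ≥0∞ → ℝ≥0∞) (f : EuclideanSpace ℝ (Fin n) → ε) : ℝ≥0∞ :=
  ⨆ (c : ℝ≥0) (_ : 0 < c), luxNorm Φ ({x | (c : ℝ≥0∞) < ‖f x‖ₑ}.indicator fun _ => (c : ℝ≥0∞))

/-- `f ∈ L^Φ(ℝⁿ)`. -/
def MemOrlicz (Φ : ℝ≥0∞ → ℝ≥0∞) (f : EuclideanSpace ℝ (Fin n) → ε) : Prop :=
  LocallyIntegrable f volume ∧ ∃ k : ℝ≥0, 0 < k ∧ ∫⁻ x, Φ (k * ‖f x‖ₑ) < ∞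

/-- `f ∈ WL^Φ(ℝⁿ)`. -/
def MemWeakOrlicz (Φ : ℝ≥0∞ → ℝ≥0∞) (f : EuclideanSpace ℝ (Fin n) → ε) : Prop :=
  AEStronglyMeasurable f volume ∧ weakLuxNorm Φ f < ∞

/-- The norm of the generalized Orlicz-Morrey space of the third kind `𝓜^{Φ,φ}(ℝⁿ)`. -/
def morreyNorm (Φ : ℝ≥0∞ → ℝ≥0∞) (φ : ℝ≥0 → ℝ≥0) (f : EuclideanSpace ℝ (Fin n) → ε) : ℝ≥0∞ :=
  ⨆ (x : EuclideanSpace ℝ (Fin n)) (r : ℝ≥0) (_ : 0 < r),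
    (φ r : ℝ≥0∞)⁻¹ * invScale n Φ r * luxNorm Φ ((Metric.ball x r).indicator f)

/-- The quasi-norm of the weak space `W𝓜^{Φ,φ}(ℝⁿ)`. -/
def weakMorreyNorm (Φ : ℝ≥0∞ → ℝ≥0∞) (φ : ℝ≥0 → ℝ≥0) (f : EuclideanSpace ℝ (Fin n) → ε) :
    ℝ≥0∞ :=
  ⨆ (x : EuclideanSpace ℝ (Fin n)) (r : ℝ≥0) (_ : 0 < r),
    (φ r : ℝ≥0∞)⁻¹ * invScale n Φ r * weakLuxNorm Φ ((Metric.ball x r).indicator f)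

/-- `f ∈ 𝓜^{Φ,φ}(ℝⁿ)`: `f` is measurable, belongs to `L^Φ_loc(ℝⁿ)` and has finite norm. -/
structure MemMorrey (Φ : ℝ≥0∞ → ℝ≥0∞) (φ : ℝ≥0 → ℝ≥0) (f : EuclideanSpace ℝ (Fin n) → ε) :
    Prop where
  aestronglyMeasurable : AEStronglyMeasurable f volume
  memLoc : ∀ (x : EuclideanSpace ℝ (Fin n)) (r : ℝ≥0), 0 < r →
    MemOrlicz Φ ((Metric.ball x r).indicator f)
  norm_lt_top : morreyNorm Φ φ f < ∞

/-- `f ∈ W𝓜^{Φ,φ}(ℝⁿ)`: `f` is measurable, belongs to `WL^Φ_loc(ℝⁿ)` and has finite quasi-norm. -/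
structure MemWeakMorrey (Φ : ℝ≥0∞ → ℝ≥0∞) (φ : ℝ≥0 → ℝ≥0)
    (f : EuclideanSpace ℝ (Fin n) → ε) : Prop where
  aestronglyMeasurable : AEStronglyMeasurable f volume
  memLoc : ∀ (x : EuclideanSpace ℝ (Fin n)) (r : ℝ≥0), 0 < r →
    MemWeakOrlicz Φ ((Metric.ball x r).indicator f)
  norm_lt_top : weakMorreyNorm Φ φ f < ∞

/-- The generalized fractional maximal operator
`M_ρ f(x) = sup_{r > 0} ρ(r) / |B(x,r)| ∫_{B(x,r)} |f(y)| dy`. -/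
def fracMaximal (ρ : ℝ≥0 → ℝ≥0) (f : EuclideanSpace ℝ (Fin n) → ε)
    (x : EuclideanSpace ℝ (Fin n)) : ℝ≥0∞ :=
  ⨆ (r : ℝ≥0) (_ : 0 < r),
    (ρ r : ℝ≥0∞) / volume (Metric.ball x (r : ℝ)) * ∫⁻ y in Metric.ball x (r : ℝ), ‖f y‖ₑ

end Spaces

/-- `M_ρ`, acting on `𝕜`-valued functions, is bounded from `𝓜^{Φ,φ₁}(ℝⁿ)` to `𝓜^{Ψ,φ₂}(ℝⁿ)`. -/
def StrongBounded (n : ℕ) (𝕜 : Type*) [RCLike 𝕜] (ρ : ℝ≥0 → ℝ≥0) (Φ : ℝ≥0∞ → ℝ≥0∞)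
    (φ₁ : ℝ≥0 → ℝ≥0) (Ψ : ℝ≥0∞ → ℝ≥0∞) (φ₂ : ℝ≥0 → ℝ≥0) : Prop :=
  ∃ C : ℝ≥0, ∀ f : EuclideanSpace ℝ (Fin n) → 𝕜, MemMorrey Φ φ₁ f →
    MemMorrey Ψ φ₂ (fracMaximal ρ f) ∧
      morreyNorm Ψ φ₂ (fracMaximal ρ f) ≤ C * morreyNorm Φ φ₁ f

/-- `M_ρ`, acting on `𝕜`-valued functions, is bounded from `𝓜^{Φ,φ₁}(ℝⁿ)` to `W𝓜^{Ψ,φ₂}(ℝⁿ)`. -/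
def WeakBounded (n : ℕ) (𝕜 : Type*) [RCLike 𝕜] (ρ : ℝ≥0 → ℝ≥0) (Φ : ℝ≥0∞ → ℝ≥0∞)
    (φ₁ : ℝ≥0 → ℝ≥0) (Ψ : ℝ≥0∞ → ℝ≥0∞) (φ₂ : ℝ≥0 → ℝ≥0) : Prop :=
  ∃ C : ℝ≥0, ∀ f : EuclideanSpace ℝ (Fin n) → 𝕜, MemMorrey Φ φ₁ f →
    MemWeakMorrey Ψ φ₂ (fracMaximal ρ f) ∧
      weakMorreyNorm Ψ φ₂ (fracMaximal ρ f) ≤ C * morreyNorm Φ φ₁ f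

/-- `ρ` is increasing and `r ↦ r⁻ⁿ ρ(r)` is decreasing on `(0,∞)`. -/
def AdmissibleRho (n : ℕ) (ρ : ℝ≥0 → ℝ≥0) : Prop :=
  MonotoneOn ρ (Ioi 0) ∧ AntitoneOn (fun r => (r ^ n)⁻¹ * ρ r) (Ioi 0)

/-- `ρ(r) ≤ C Ψ⁻¹(r⁻ⁿ) / Φ⁻¹(r⁻ⁿ)` for all `r > 0`. -/
def RhoCondition (n : ℕ) (ρ : ℝ≥0 → ℝ≥0) (Φ Ψ : ℝ≥0∞ → ℝ≥0∞) : Prop :=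
  ∃ C : ℝ≥0, ∀ r : ℝ≥0, 0 < r → (ρ r : ℝ≥0∞) ≤ C * (invScale n Ψ r / invScale n Φ r)

/-- `φ₁(r) / Φ⁻¹(r⁻ⁿ) ≤ C φ₂(r) / Ψ⁻¹(r⁻ⁿ)` for all `r > 0`. -/
def PhiCondition (n : ℕ) (Φ Ψ : ℝ≥0∞ → ℝ≥0∞) (φ₁ φ₂ : ℝ≥0 → ℝ≥0) : Prop :=
  ∃ C : ℝ≥0, ∀ r : ℝ≥0, 0 < r →
    (φ₁ r : ℝ≥0∞) / invScale n Φ r ≤ C * ((φ₂ r : ℝ≥0∞) / invScale n Ψ r)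

/-- `sup_{r < t < ∞} φ₁(t) ρ(t) ≤ C φ₂(r)` for all `r > 0`. -/
def SupCondition (ρ φ₁ φ₂ : ℝ≥0 → ℝ≥0) : Prop :=
  ∃ C : ℝ≥0, ∀ r : ℝ≥0, 0 < r →
    ⨆ (t : ℝ≥0) (_ : r < t), ((φ₁ t * ρ t : ℝ≥0) : ℝ≥0∞) ≤ ((C * φ₂ r : ℝ≥0) : ℝ≥0∞)

/-- `φ₁(r) ρ(r) ≤ C φ₂(r)` for all `r > 0`. -/
def PointCondition (ρ φ₁ φ₂ : ℝ≥0 → ℝ≥0) : Prop :=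
  ∃ C : ℝ≥0, ∀ r : ℝ≥0, 0 < r → φ₁ r * ρ r ≤ C * φ₂ r

end OrliczMorrey

end

/-! Sufficiency rests on a Hedberg type estimate. Let `∫ Φ(g) ≤ 1`, and suppose that at `x` all
averages of `g` are at most `2 Φ⁻¹(s)`. Take the radius `t₀` with `t₀⁻ⁿ = s`. For `t ≤ t₀`,
monotonicity of `ρ` and (a) at `t₀` bound `ρ(t)` times the average by a multiple of `Ψ⁻¹(s)`. For `t
≥ t₀`, the embedding of `L^Φ` into `L¹` on balls gives an average of order `Φ⁻¹(t⁻ⁿ)`, and (a) at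
`t` leads to `Ψ⁻¹(t⁻ⁿ) ≤ Ψ⁻¹(s)`. This is `fracMaximal_le_youngInv`.

By Jensen, the assumption on averages holds off the set where the Hardy-Littlewood maximal function
of `Φ(g)` exceeds `s`, so the weak type `(1,1)` inequality yields the bound from `L^Φ` to `WL^Ψ`. It
also holds for every positive finite `s ≥ Φ(Mg(x))`, `M` being the Hardy-Littlewood operator. Hence
`Ψ` of a multiple of `M_ρ g` is dominated by `Φ(Mg)`, and the modular inequality for `M` under `∇₂`
yields the strong bound.

To reach Morrey spaces, fix a ball `B` of radius `r`. At points of `B`, radii `t ≤ r` see only `f`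
on `2B`, where the Orlicz bound, (b) and a doubling property of `φ₂ / Ψ⁻¹(·⁻ⁿ)` apply. Radii `t > r`
contribute at most a multiple of `φ₁(t) ρ(t) ‖f‖`, hence of `φ₂(r) ‖f‖` by (c). See
`fracMaximal_ball_le_max` and `exists_local_estimate`.

For necessity, test on `χ_{B(0,r)}`: its norm is `O(1/φ₁(r))`, while `M_ρ` of it is at least `2⁻ⁿ
ρ(r)` on the ball. If `φ₂` is almost decreasing, (d) implies (c), which gives the characterization.
-/

noncomputable section

namespace OrliczMorrey

variable {Φ Ψ : ℝ≥0∞ → ℝ≥0∞} {n : ℕ}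

/-! ### Young functions and their generalized inverses -/

/-- Convexity on the segment from `0`, where `Φ` vanishes, to `u`. All later uses of convexity go
through this inequality. -/
lemma IsYoung.map_mul_le (hΦ : IsYoung Φ) {k : ℝ≥0∞} (hk : k ≤ 1) (u : ℝ≥0∞) :
    Φ (k * u) ≤ k * Φ u := by
  lift k to ℝ≥0 using ne_top_of_le_ne_top ENNReal.one_ne_top hk
  have hk' : k ≤ 1 := by exact_mod_cast hk
  have := hΦ.convex.2 (mem_univ u) (mem_univ 0) (zero_le (a := k)) (zero_le (a := 1 - k))
    (add_tsub_cancel_of_le hk')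
  simpa [hΦ.map_zero, ENNReal.smul_def] using this

lemma IsYoung.monotone (hΦ : IsYoung Φ) : Monotone Φ := by
  intro a b hab
  rcases eq_or_ne b ∞ with rfl | hb
  · rw [hΦ.map_top]; exact le_top
  rcases eq_or_ne b 0 with rfl | hb0
  · rw [le_zero_iff.1 hab]
  have h1 : a / b ≤ 1 := ENNReal.div_le_of_le_mul (by simpa using hab)
  calc Φ a = Φ (a / b * b) := by rw [ENNReal.div_mul_cancel hb0 hb]
    _ ≤ a / b * Φ b := hΦ.map_mul_le h1 b
    _ ≤ 1 * Φ b := by gcongr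
    _ = Φ b := one_mul _

lemma IsYoung.measurable (hΦ : IsYoung Φ) : Measurable Φ := hΦ.monotone.measurable

lemma IsYoung.mul_le_map_mul (hΦ : IsYoung Φ) {k : ℝ≥0∞} (hk : 1 ≤ k) (hk' : k ≠ ∞) (u : ℝ≥0∞) :
    k * Φ u ≤ Φ (k * u) := by
  have hk0 : k ≠ 0 := (zero_lt_one.trans_le hk).ne'
  have h := hΦ.map_mul_le (ENNReal.inv_le_one.2 hk) (k * u)
  rw [← mul_assoc, ENNReal.inv_mul_cancel hk0 hk', one_mul] at h
  calc k * Φ u ≤ k * (k⁻¹ * Φ (k * u)) := by gcongr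
    _ = Φ (k * u) := by rw [← mul_assoc, ENNReal.mul_inv_cancel hk0 hk', one_mul]

lemma IsYoung.id : IsYoung fun t => t where
  convex := convexOn_id convex_univ
  leftCont _ _ := continuousWithinAt_id
  map_zero := rfl
  tendsto_zero := tendsto_id.mono_left nhdsWithin_le_nhds
  map_top := rfl
  tendsto_top := tendsto_id.mono_left nhdsWithin_le_nhds

lemma youngInv_le_of_lt {s u : ℝ≥0∞} (h : s < Φ u) : youngInv Φ s ≤ u := sInf_le h

lemma youngInv_mono {s t : ℝ≥0∞} (h : s ≤ t) : youngInv Φ s ≤ youngInv Φ t :=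
  sInf_le_sInf fun _ hr => h.trans_lt hr

/-- The strict inequality is why later arguments evaluate `Φ` at half of `Φ⁻¹(s)`, at the cost of a
factor `2`. -/
lemma map_le_of_lt_youngInv {s u : ℝ≥0∞} (h : u < youngInv Φ s) : Φ u ≤ s :=
  not_lt.1 fun hs => (youngInv_le_of_lt hs).not_gt h

lemma IsYoung.le_youngInv (hΦ : IsYoung Φ) {s u : ℝ≥0∞} (h : Φ u ≤ s) : u ≤ youngInv Φ s :=
  le_sInf fun _ hr => le_of_not_ge fun hru => (h.trans_lt hr).not_ge (hΦ.monotone hru)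

lemma IsYoung.lt_map_of_youngInv_lt (hΦ : IsYoung Φ) {s u : ℝ≥0∞} (h : youngInv Φ s < u) :
    s < Φ u :=
  not_le.1 fun hs => (hΦ.le_youngInv hs).not_gt h

/-- A weak form of concavity of the inverse. It lets `|B|⁻¹` be replaced by `r⁻ⁿ` inside `Φ⁻¹`. -/
lemma IsYoung.youngInv_mul_le (hΦ : IsYoung Φ) {k : ℝ≥0∞} (hk : 1 ≤ k) (hk' : k ≠ ∞)
    (s : ℝ≥0∞) : youngInv Φ (k * s) ≤ k * youngInv Φ s := by
  have hk0 : k ≠ 0 := (zero_lt_one.trans_le hk).ne'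
  rw [mul_comm k (youngInv Φ s), ← ENNReal.div_le_iff hk0 hk']
  refine le_sInf fun r hr => ?_
  rw [ENNReal.div_le_iff hk0 hk', mul_comm r]
  exact youngInv_le_of_lt ((ENNReal.mul_lt_mul_right hk0 hk' hr).trans_le
    (hΦ.mul_le_map_mul hk hk' r))

lemma IsYoung.youngInv_ne_zero (hΦ : IsYoung Φ) {s : ℝ≥0∞} (hs : s ≠ 0) :
    youngInv Φ s ≠ 0 := by
  have h : ∀ᶠ r in 𝓝[>] (0 : ℝ≥0∞), Φ r < s :=
    hΦ.tendsto_zero.eventually (gt_mem_nhds (pos_iff_ne_zero.2 hs))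
  obtain ⟨r, hr, hr0⟩ := (h.and self_mem_nhdsWithin).exists
  exact ((show 0 < r from hr0).trans_le (hΦ.le_youngInv hr.le)).ne'

lemma IsYoung.exists_lt_map (hΦ : IsYoung Φ) {s : ℝ≥0∞} (hs : s ≠ ∞) :
    ∃ r ≠ ∞, s < Φ r := by
  have h : ∀ᶠ r in 𝓝[<] ∞, s < Φ r :=
    hΦ.tendsto_top.eventually (lt_mem_nhds (lt_top_iff_ne_top.2 hs))
  have : (𝓝[<] (∞ : ℝ≥0∞)).NeBot := nhdsLT_neBot_of_exists_lt ⟨0, ENNReal.zero_lt_top⟩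
  obtain ⟨r, hr, hr0⟩ := (h.and self_mem_nhdsWithin).exists
  exact ⟨r, ne_of_lt hr0, hr⟩

lemma IsYoung.youngInv_ne_top (hΦ : IsYoung Φ) {s : ℝ≥0∞} (hs : s ≠ ∞) :
    youngInv Φ s ≠ ∞ := by
  obtain ⟨r, hr, h⟩ := hΦ.exists_lt_map hs
  exact ne_top_of_le_ne_top hr (youngInv_le_of_lt h)

/-- Pointwise substitute for Jensen: either `u ≤ M`, or `Φ(u) / u ≥ Φ(M) / M ≥ s / M` because `Φ(u)
/ u` is nondecreasing. -/
lemma IsYoung.mul_le_mul_add (hΦ : IsYoung Φ) {s M : ℝ≥0∞} (hs : s ≠ 0) (hM : M ≠ ∞)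
    (h : s ≤ Φ M) (u : ℝ≥0∞) : s * u ≤ M * (s + Φ u) := by
  rcases le_total u M with hu | hu
  · calc s * u ≤ s * M := by gcongr
      _ = M * s := mul_comm _ _
      _ ≤ _ := by gcongr; exact le_self_add
  have hM0 : M ≠ 0 := by
    rintro rfl
    rw [hΦ.map_zero] at h
    exact hs (le_zero_iff.1 h)
  rcases eq_or_ne u ∞ with rfl | hu'
  · rw [hΦ.map_top, add_top, ENNReal.mul_top hM0]; exact le_top
  have hu0 : u ≠ 0 := ((pos_iff_ne_zero.2 hM0).trans_le hu).ne'
  have h1 : M / u ≤ 1 := ENNReal.div_le_of_le_mul (by simpa using hu)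
  have h2 : s ≤ M / u * Φ u := h.trans <| by
    simpa [ENNReal.div_mul_cancel hu0 hu'] using hΦ.map_mul_le h1 u
  calc s * u ≤ M / u * Φ u * u := by gcongr
    _ = M / u * u * Φ u := by ring
    _ = M * Φ u := by rw [ENNReal.div_mul_cancel hu0 hu']
    _ ≤ _ := by gcongr; exact le_add_self

/-- Jensen's inequality up to the factor `2`. -/
lemma IsYoung.lintegral_le_of_lintegral_map_le {α : Type*} [MeasurableSpace α] {μ : Measure α}
    (hΦ : IsYoung Φ) {g : α → ℝ≥0∞} {s : ℝ≥0∞} (hs : s ≠ 0) (hs' : s ≠ ∞)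
    (h : ∫⁻ x, Φ (g x) ∂μ ≤ s * μ univ) :
    ∫⁻ x, g x ∂μ ≤ 2 * youngInv Φ s * μ univ := by
  -- For `M` strictly above `Φ⁻¹(s)` one has `s < Φ(M)`. Each of the two summands `s` and `Φ(g)`
  -- integrates to at most `s μ(univ)`, whence the factor `2`. The endpoint follows on letting `M`
  -- decrease to `Φ⁻¹(s)`.
  have key : ∀ M ≠ ∞, youngInv Φ s < M → ∫⁻ x, g x ∂μ ≤ 2 * M * μ univ := by
    intro M hM hlt
    have h1 : s * ∫⁻ x, g x ∂μ ≤ s * (2 * M * μ univ) :=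
      calc s * ∫⁻ x, g x ∂μ = ∫⁻ x, s * g x ∂μ := (lintegral_const_mul' _ _ hs').symm
        _ ≤ ∫⁻ x, M * (s + Φ (g x)) ∂μ := lintegral_mono fun x =>
            hΦ.mul_le_mul_add hs hM (hΦ.lt_map_of_youngInv_lt hlt).le (g x)
        _ = M * (s * μ univ + ∫⁻ x, Φ (g x) ∂μ) := by
            rw [lintegral_const_mul' _ _ hM, lintegral_add_left measurable_const, lintegral_const]
        _ ≤ M * (s * μ univ + s * μ univ) := by gcongr
        _ = _ := by ring
    exact (ENNReal.mul_le_mul_iff_right hs hs').1 h1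
  rcases eq_or_ne (μ univ) ∞ with hμ | hμ
  · rw [hμ, ENNReal.mul_top (mul_ne_zero two_ne_zero (hΦ.youngInv_ne_zero hs))]
    exact le_top
  have hlim : Tendsto (fun M => 2 * M * μ univ) (𝓝[>] (youngInv Φ s))
      (𝓝 (2 * youngInv Φ s * μ univ)) := by
    refine Tendsto.mono_left ?_ nhdsWithin_le_nhds
    exact ENNReal.Tendsto.mul_const (ENNReal.Tendsto.const_mul tendsto_id (Or.inr (by simp)))
      (Or.inr hμ)
  have hlt := lt_top_iff_ne_top.2 (hΦ.youngInv_ne_top hs')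
  have : (𝓝[>] (youngInv Φ s)).NeBot := nhdsGT_neBot_of_exists_gt ⟨∞, hlt⟩
  refine ge_of_tendsto hlim ?_
  filter_upwards [self_mem_nhdsWithin, mem_nhdsWithin_of_mem_nhds (gt_mem_nhds hlt)] with M h1 h2
  exact key M h2.ne h1

/-- If `youngInv Φ` controls `u` at all levels above `t`, then `Φ (u / 2) ≤ t`. -/
lemma IsYoung.map_half_le (hΦ : IsYoung Φ) {u t : ℝ≥0∞}
    (h : ∀ s, s ≠ 0 → s ≠ ∞ → t ≤ s → u ≤ youngInv Φ s) : Φ (u / 2) ≤ t := by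
  refine le_of_forall_gt_imp_ge_of_dense fun s hs => ?_
  rcases eq_or_ne s ∞ with rfl | hs'
  · exact le_top
  have hs0 : s ≠ 0 := (zero_le.trans_lt hs).ne'
  have hu := h s hs0 hs' hs.le
  rcases eq_or_ne u 0 with rfl | hu0
  · simp [hΦ.map_zero]
  refine map_le_of_lt_youngInv (lt_of_lt_of_le (ENNReal.half_lt_self hu0 ?_) hu)
  exact ne_top_of_le_ne_top (hΦ.youngInv_ne_top hs') hu

/-! ### The function `invScale` -/

lemma inv_pow_ne_zero (r : ℝ≥0) : ((r : ℝ≥0∞) ^ n)⁻¹ ≠ 0 := by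
  simp [ENNReal.pow_eq_top_iff]

lemma inv_pow_ne_top {r : ℝ≥0} (hr : 0 < r) : ((r : ℝ≥0∞) ^ n)⁻¹ ≠ ∞ := by
  simp [hr.ne']

lemma IsYoung.invScale_ne_zero (hΦ : IsYoung Φ) (r : ℝ≥0) : invScale n Φ r ≠ 0 :=
  hΦ.youngInv_ne_zero (inv_pow_ne_zero r)

lemma IsYoung.invScale_ne_top (hΦ : IsYoung Φ) {r : ℝ≥0} (hr : 0 < r) : invScale n Φ r ≠ ∞ :=
  hΦ.youngInv_ne_top (inv_pow_ne_top hr)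

lemma invScale_anti {r t : ℝ≥0} (h : r ≤ t) : invScale n Φ t ≤ invScale n Φ r :=
  youngInv_mono (ENNReal.inv_le_inv.2 (by gcongr))

/-! ### Balls -/

/-- The volume of the unit ball. -/
def unitVol (n : ℕ) : ℝ≥0∞ := volume (Metric.ball (0 : EuclideanSpace ℝ (Fin n)) 1)

/-- A constant dominating `1`, the volume of the unit ball and its inverse. -/
def volConst (n : ℕ) : ℝ≥0∞ := max 1 (max (unitVol n) (unitVol n)⁻¹)

lemma unitVol_ne_zero : unitVol n ≠ 0 := (Metric.measure_ball_pos _ _ one_pos).ne'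

lemma unitVol_ne_top : unitVol n ≠ ∞ := measure_ball_lt_top.ne

lemma one_le_volConst : 1 ≤ volConst n := le_max_left _ _

lemma unitVol_le_volConst : unitVol n ≤ volConst n := (le_max_left _ _).trans (le_max_right _ _)

lemma inv_unitVol_le_volConst : (unitVol n)⁻¹ ≤ volConst n :=
  (le_max_right _ _).trans (le_max_right _ _)

lemma volConst_ne_top : volConst n ≠ ∞ := by
  simp [volConst, unitVol_ne_top, unitVol_ne_zero]

lemma volConst_ne_zero : volConst n ≠ 0 := (zero_lt_one.trans_le one_le_volConst).ne'

lemma volume_ball_nnreal (x : EuclideanSpace ℝ (Fin n)) {r : ℝ≥0} (hr : 0 < r) :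
    volume (Metric.ball x (r : ℝ)) = (r : ℝ≥0∞) ^ n * unitVol n := by
  rw [Measure.addHaar_ball_of_pos volume x (by exact_mod_cast hr), finrank_euclideanSpace_fin,
    ENNReal.ofReal_pow r.coe_nonneg, ENNReal.ofReal_coe_nnreal, unitVol]

lemma volume_closedBall_nnreal (x : EuclideanSpace ℝ (Fin n)) (r : ℝ≥0) :
    volume (Metric.closedBall x (r : ℝ)) = (r : ℝ≥0∞) ^ n * unitVol n := by
  rw [Measure.addHaar_closedBall volume x r.coe_nonneg, finrank_euclideanSpace_fin,
    ENNReal.ofReal_pow r.coe_nonneg, ENNReal.ofReal_coe_nnreal, unitVol]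

lemma volume_ball_ne_zero (x : EuclideanSpace ℝ (Fin n)) {r : ℝ≥0} (hr : 0 < r) :
    volume (Metric.ball x (r : ℝ)) ≠ 0 :=
  (Metric.measure_ball_pos _ _ (by exact_mod_cast hr)).ne'

lemma inv_volume_ball_le (x : EuclideanSpace ℝ (Fin n)) {r : ℝ≥0} (hr : 0 < r) :
    (volume (Metric.ball x (r : ℝ)))⁻¹ ≤ volConst n * ((r : ℝ≥0∞) ^ n)⁻¹ := by
  rw [volume_ball_nnreal x hr, ENNReal.mul_inv (Or.inr unitVol_ne_top) (Or.inr unitVol_ne_zero),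
    mul_comm]
  gcongr
  exact inv_unitVol_le_volConst

lemma inv_pow_mul_volume_ball_le (x : EuclideanSpace ℝ (Fin n)) {r : ℝ≥0} (hr : 0 < r) :
    ((r : ℝ≥0∞) ^ n)⁻¹ * volume (Metric.ball x (r : ℝ)) ≤ volConst n := by
  rw [volume_ball_nnreal x hr, ← mul_assoc, ENNReal.inv_mul_cancel (by simp [hr.ne'])
    (by simp [ENNReal.pow_eq_top_iff]), one_mul]
  exact unitVol_le_volConst

lemma IsYoung.youngInv_inv_volume_ball_le (hΦ : IsYoung Φ) (x : EuclideanSpace ℝ (Fin n))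
    {r : ℝ≥0} (hr : 0 < r) :
    youngInv Φ (volume (Metric.ball x (r : ℝ)))⁻¹ ≤ volConst n * invScale n Φ r :=
  (youngInv_mono (inv_volume_ball_le x hr)).trans
    (hΦ.youngInv_mul_le one_le_volConst volConst_ne_top _)

/-- The embedding of `L^Φ` into `L¹` on a ball, in modular form. -/
lemma IsYoung.setLIntegral_ball_le (hΦ : IsYoung Φ) {g : EuclideanSpace ℝ (Fin n) → ℝ≥0∞}
    (x : EuclideanSpace ℝ (Fin n)) {r : ℝ≥0} (hr : 0 < r)
    (h : ∫⁻ y in Metric.ball x (r : ℝ), Φ (g y) ≤ 1) :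
    ∫⁻ y in Metric.ball x (r : ℝ), g y ≤
      2 * (volConst n * invScale n Φ r) * volume (Metric.ball x (r : ℝ)) := by
  have h0 := volume_ball_ne_zero x hr
  have h1 : volume (Metric.ball x (r : ℝ)) ≠ ∞ := measure_ball_lt_top.ne
  have := hΦ.lintegral_le_of_lintegral_map_le (μ := volume.restrict (Metric.ball x (r : ℝ)))
    (g := g) (ENNReal.inv_ne_zero.2 h1) (ENNReal.inv_ne_top.2 h0)
    (by rwa [Measure.restrict_apply_univ, ENNReal.inv_mul_cancel h0 h1])
  rw [Measure.restrict_apply_univ] at this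
  refine this.trans ?_
  gcongr
  exact hΦ.youngInv_inv_volume_ball_le x hr

/-! ### Maximal functions -/

/-- If the integral exceeds `a`, it already does so on a slightly smaller concentric ball, which
stays inside the ball of radius `r` after a small shift of the centre. No measurability of `g` is
needed. -/
lemma lowerSemicontinuous_setLIntegral_ball (g : EuclideanSpace ℝ (Fin n) → ℝ≥0∞) (r : ℝ) :
    LowerSemicontinuous fun x => ∫⁻ y in Metric.ball x r, g y := by
  intro x a ha
  have hU : Metric.ball x r = ⋃ k : ℕ, Metric.ball x (r - ((k : ℝ) + 1)⁻¹) := by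
    ext y
    simp only [Metric.mem_ball, mem_iUnion]
    constructor
    · intro hy
      obtain ⟨k, hk⟩ := exists_nat_one_div_lt (sub_pos.2 hy)
      exact ⟨k, by rw [one_div] at hk; linarith⟩
    · rintro ⟨k, hk⟩
      have : 0 < ((k : ℝ) + 1)⁻¹ := by positivity
      linarith
  have hmono : Monotone fun k : ℕ => Metric.ball x (r - ((k : ℝ) + 1)⁻¹) := by
    intro k l hkl
    refine Metric.ball_subset_ball (sub_le_sub_left ?_ _)
    gcongr
  have ha' : a < ∫⁻ y in Metric.ball x r, g y := ha
  rw [hU, setLIntegral_iUnion_of_directed _ hmono.directed_le, lt_iSup_iff] at ha'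
  obtain ⟨k, hk⟩ := ha'
  have hpos : 0 < ((k : ℝ) + 1)⁻¹ := by positivity
  filter_upwards [Metric.ball_mem_nhds x hpos] with x' hx'
  refine hk.trans_le (lintegral_mono_set (Metric.ball_subset_ball' ?_))
  rw [dist_comm]
  have := Metric.mem_ball.1 hx'
  linarith

lemma lowerSemicontinuous_fracMaximal (ρ : ℝ≥0 → ℝ≥0)
    (g : EuclideanSpace ℝ (Fin n) → ℝ≥0∞) : LowerSemicontinuous (fracMaximal ρ g) := by
  refine lowerSemicontinuous_iSup fun r => lowerSemicontinuous_iSup fun hr => ?_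
  have h : ∀ x : EuclideanSpace ℝ (Fin n), (ρ r : ℝ≥0∞) / volume (Metric.ball x (r : ℝ)) =
      ρ r / volume (Metric.ball (0 : EuclideanSpace ℝ (Fin n)) (r : ℝ)) := fun x => by
    rw [Measure.addHaar_ball_center]
  simp only [h, enorm_eq_self]
  refine Continuous.comp_lowerSemicontinuous (ENNReal.continuous_const_mul ?_)
    (lowerSemicontinuous_setLIntegral_ball g r) fun a b hab => by gcongr
  exact ENNReal.div_ne_top ENNReal.coe_ne_top (volume_ball_ne_zero 0 hr)

lemma measurable_fracMaximal (ρ : ℝ≥0 → ℝ≥0)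
    (g : EuclideanSpace ℝ (Fin n) → ℝ≥0∞) : Measurable (fracMaximal ρ g) :=
  (lowerSemicontinuous_fracMaximal ρ g).measurable

lemma fracMaximal_le_iff {ρ : ℝ≥0 → ℝ≥0} {g : EuclideanSpace ℝ (Fin n) → ℝ≥0∞}
    {x : EuclideanSpace ℝ (Fin n)} {a : ℝ≥0∞} :
    fracMaximal ρ g x ≤ a ↔ ∀ r : ℝ≥0, 0 < r →
      ρ r / volume (Metric.ball x (r : ℝ)) * ∫⁻ y in Metric.ball x (r : ℝ), g y ≤ a := by
  simp only [fracMaximal, iSup_le_iff, enorm_eq_self]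

lemma le_fracMaximal (ρ : ℝ≥0 → ℝ≥0) (g : EuclideanSpace ℝ (Fin n) → ℝ≥0∞)
    (x : EuclideanSpace ℝ (Fin n)) {r : ℝ≥0} (hr : 0 < r) :
    ρ r / volume (Metric.ball x (r : ℝ)) * ∫⁻ y in Metric.ball x (r : ℝ), g y ≤
      fracMaximal ρ g x :=
  fracMaximal_le_iff.1 le_rfl r hr

lemma fracMaximal_const_mul (ρ : ℝ≥0 → ℝ≥0) (g : EuclideanSpace ℝ (Fin n) → ℝ≥0∞)
    {c : ℝ≥0∞} (hc : c ≠ ∞) (x : EuclideanSpace ℝ (Fin n)) :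
    fracMaximal ρ (fun y => c * g y) x = c * fracMaximal ρ g x := by
  simp only [fracMaximal, enorm_eq_self, ENNReal.mul_iSup, lintegral_const_mul' _ _ hc,
    mul_left_comm]

/-- Reduces everything about `M_ρ` to `[0,∞]`-valued functions. -/
lemma fracMaximal_enorm {ε : Type*} [TopologicalSpace ε] [ESeminormedAddMonoid ε]
    (ρ : ℝ≥0 → ℝ≥0) (f : EuclideanSpace ℝ (Fin n) → ε) :
    fracMaximal ρ f = fracMaximal ρ fun x => ‖f x‖ₑ := by
  ext x
  simp only [fracMaximal, enorm_eq_self]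

/-- The set where the Hardy-Littlewood maximal function of `h` exceeds `s`. -/
def maximalSuperlevel (s : ℝ≥0∞) (h : EuclideanSpace ℝ (Fin n) → ℝ≥0∞) :
    Set (EuclideanSpace ℝ (Fin n)) :=
  {x | ∃ t : ℝ≥0, 0 < t ∧
    s * volume (Metric.ball x (t : ℝ)) < ∫⁻ y in Metric.ball x (t : ℝ), h y}

/-- The weak type `(1,1)` inequality. -/
lemma mul_volume_maximalSuperlevel_le (hn : 0 < n) {s : ℝ≥0∞} (hs : s ≠ 0) (hs' : s ≠ ∞)
    (h : EuclideanSpace ℝ (Fin n) → ℝ≥0∞) :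
    s * volume (maximalSuperlevel s h) ≤ 5 ^ n * ∫⁻ y, h y := by
  rcases eq_or_ne (∫⁻ y, h y) ∞ with hI | hI
  · rw [hI, ENNReal.mul_top (by simp)]; exact le_top
  choose! τ hτ hτ' using fun x (hx : x ∈ maximalSuperlevel s h) => hx
  have hsv : s * unitVol n ≠ 0 := mul_ne_zero hs unitVol_ne_zero
  have hsv' : s * unitVol n ≠ ∞ := ENNReal.mul_ne_top hs' unitVol_ne_top
  set Q : ℝ≥0∞ := (∫⁻ y, h y) / (s * unitVol n) with hQ
  have hQ' : Q ≠ ∞ := ENNReal.div_ne_top hI hsv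
  -- The Vitali covering needs bounded radii. Here `τⁿ ≤ Q` and `n > 0` give `τ ≤ max 1 Q` without
  -- taking roots.
  have hbound : ∀ x ∈ maximalSuperlevel s h, (τ x : ℝ) ≤ max 1 Q.toNNReal := by
    intro x hx
    have h1 : (τ x : ℝ≥0∞) ^ n ≤ Q := by
      rw [hQ, ENNReal.le_div_iff_mul_le (Or.inl hsv) (Or.inl hsv')]
      calc (τ x : ℝ≥0∞) ^ n * (s * unitVol n) = s * volume (Metric.ball x (τ x : ℝ)) := by
            rw [volume_ball_nnreal x (hτ x hx)]; ring
        _ ≤ _ := (hτ' x hx).le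
        _ ≤ _ := setLIntegral_le_lintegral _ _
    have h2 : τ x ^ n ≤ Q.toNNReal := by
      rw [← ENNReal.coe_le_coe, ENNReal.coe_toNNReal hQ']
      exact_mod_cast h1
    rcases le_total (τ x) 1 with h3 | h3
    · exact le_max_of_le_left (by exact_mod_cast h3)
    · exact le_max_of_le_right (by exact_mod_cast (le_self_pow₀ h3 hn.ne').trans h2)
  obtain ⟨u, hu, hdisj, hcov⟩ := Vitali.exists_disjoint_subfamily_covering_enlargement_closedBall
    (maximalSuperlevel s h) id (fun x => (τ x : ℝ)) _ hbound 5 (by norm_num)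
  have hcount : u.Countable := by
    refine hdisj.countable_of_nonempty_interior fun x hx => ⟨x, ?_⟩
    refine Metric.ball_subset_interior_closedBall (Metric.mem_ball_self ?_)
    exact_mod_cast hτ x (hu hx)
  have hsub : maximalSuperlevel s h ⊆ ⋃ x ∈ u, Metric.closedBall x (5 * τ x) := by
    intro x hx
    obtain ⟨b, hb, hxb⟩ := hcov x hx
    exact mem_biUnion hb (hxb (Metric.mem_closedBall_self (τ x).coe_nonneg))
  have hdisj' : u.PairwiseDisjoint fun x => Metric.ball x (τ x : ℝ) :=
    hdisj.mono fun x => Metric.ball_subset_closedBall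
  calc s * volume (maximalSuperlevel s h)
      ≤ s * ∑' x : u, volume (Metric.closedBall (x : EuclideanSpace ℝ (Fin n)) (5 * τ x)) := by
        gcongr
        exact (measure_mono hsub).trans (measure_biUnion_le _ hcount _)
    _ = ∑' x : u, s * volume (Metric.closedBall (x : EuclideanSpace ℝ (Fin n)) (5 * τ x)) :=
        ENNReal.tsum_mul_left.symm
    _ ≤ ∑' x : u, 5 ^ n * ∫⁻ y in Metric.ball (x : EuclideanSpace ℝ (Fin n)) (τ x), h y := by
        refine ENNReal.tsum_le_tsum fun x => ?_
        have hx := hτ x (hu x.2)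
        have h5 := volume_closedBall_nnreal (x : EuclideanSpace ℝ (Fin n)) (5 * τ x)
        push_cast at h5
        rw [h5, mul_pow]
        calc s * (5 ^ n * (τ x : ℝ≥0∞) ^ n * unitVol n)
            = 5 ^ n * (s * volume (Metric.ball (x : EuclideanSpace ℝ (Fin n)) (τ x))) := by
              rw [volume_ball_nnreal _ hx]; ring
          _ ≤ _ := by gcongr; exact (hτ' x (hu x.2)).le
    _ = 5 ^ n * ∑' x : u, ∫⁻ y in Metric.ball (x : EuclideanSpace ℝ (Fin n)) (τ x), h y :=
        ENNReal.tsum_mul_left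
    _ = 5 ^ n * ∫⁻ y in ⋃ x ∈ u, Metric.ball x (τ x : ℝ), h y := by
        rw [lintegral_biUnion hcount (fun x _ => Metric.isOpen_ball.measurableSet) hdisj']
    _ ≤ 5 ^ n * ∫⁻ y, h y := by gcongr; exact Measure.restrict_le_self

lemma exists_inv_pow_eq (hn : 0 < n) {s : ℝ≥0∞} (hs : s ≠ 0) (hs' : s ≠ ∞) :
    ∃ t : ℝ≥0, 0 < t ∧ ((t : ℝ≥0∞) ^ n)⁻¹ = s := by
  lift s to ℝ≥0 using hs'
  have hs0 : 0 < s := pos_iff_ne_zero.2 (by simpa using hs)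
  refine ⟨(s⁻¹) ^ ((n : ℝ)⁻¹), NNReal.rpow_pos (inv_pos.2 hs0), ?_⟩
  rw [← ENNReal.coe_pow, NNReal.rpow_inv_natCast_pow _ hn.ne', ENNReal.coe_inv hs0.ne', inv_inv]

lemma mul_div_mul_le {a b c C : ℝ≥0∞} (hb : b ≠ 0) (hb' : b ≠ ∞) (h : a ≤ C * (c / b)) :
    a * b ≤ C * c := by
  calc a * b ≤ C * (c / b) * b := by gcongr
    _ = C * (c / b * b) := mul_assoc _ _ _
    _ = C * c := by rw [ENNReal.div_mul_cancel hb hb']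

/-- The pointwise (Hedberg type) estimate for `M_ρ`. -/
lemma fracMaximal_le_youngInv (hn : 0 < n) (hΦ : IsYoung Φ) {ρ : ℝ≥0 → ℝ≥0}
    (hρ : MonotoneOn ρ (Ioi 0)) {C : ℝ≥0∞}
    (hC : ∀ r : ℝ≥0, 0 < r → (ρ r : ℝ≥0∞) ≤ C * (invScale n Ψ r / invScale n Φ r))
    {g : EuclideanSpace ℝ (Fin n) → ℝ≥0∞} (hg : ∫⁻ y, Φ (g y) ≤ 1)
    {x : EuclideanSpace ℝ (Fin n)} {s : ℝ≥0∞} (hs : s ≠ 0) (hs' : s ≠ ∞)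
    (hx : ∀ t : ℝ≥0, 0 < t → ∫⁻ y in Metric.ball x (t : ℝ), g y ≤
      2 * youngInv Φ s * volume (Metric.ball x (t : ℝ))) :
    fracMaximal ρ g x ≤ 2 * volConst n * C * youngInv Ψ s := by
  -- `t₀` is the crossover radius: above it the global bound `∫ Φ(g) ≤ 1` is the better one, below
  -- it the pointwise hypothesis `hx`.
  obtain ⟨t₀, ht₀, rfl⟩ := exists_inv_pow_eq hn hs hs'
  refine fracMaximal_le_iff.2 fun t ht => ?_
  have h0 := volume_ball_ne_zero x ht
  have h1 : volume (Metric.ball x (t : ℝ)) ≠ ∞ := measure_ball_lt_top.ne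
  have hbd : ∀ t : ℝ≥0, 0 < t → ρ t * invScale n Φ t ≤ C * invScale n Ψ t := fun t ht =>
    mul_div_mul_le (hΦ.invScale_ne_zero t) (hΦ.invScale_ne_top ht) (hC t ht)
  have hcancel : ∀ a : ℝ≥0∞, ρ t / volume (Metric.ball x (t : ℝ)) *
      (a * volume (Metric.ball x (t : ℝ))) = a * ρ t := fun a => by
    rw [mul_left_comm, ENNReal.div_mul_cancel h0 h1]
  rcases le_total t₀ t with h | h
  · calc _ ≤ ρ t / volume (Metric.ball x (t : ℝ)) *
          (2 * (volConst n * invScale n Φ t) * volume (Metric.ball x (t : ℝ))) := by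
          gcongr
          exact hΦ.setLIntegral_ball_le x ht ((setLIntegral_le_lintegral _ _).trans hg)
      _ = 2 * volConst n * (ρ t * invScale n Φ t) := by rw [hcancel]; ring
      _ ≤ 2 * volConst n * (C * invScale n Ψ t) := by
          gcongr 2 * volConst n * ?_; exact hbd t ht
      _ ≤ 2 * volConst n * (C * invScale n Ψ t₀) := by gcongr; exact invScale_anti h
      _ = _ := by rw [invScale]; ring
  · calc _ ≤ ρ t / volume (Metric.ball x (t : ℝ)) *
          (2 * invScale n Φ t₀ * volume (Metric.ball x (t : ℝ))) := by
          gcongr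
          exact hx t ht
      _ = 2 * 1 * (ρ t * invScale n Φ t₀) := by rw [hcancel]; ring
      _ ≤ 2 * volConst n * (ρ t₀ * invScale n Φ t₀) := by
          gcongr
          · exact one_le_volConst
          · exact hρ ht ht₀ h
      _ ≤ 2 * volConst n * (C * invScale n Ψ t₀) := by
          gcongr 2 * volConst n * ?_; exact hbd t₀ ht₀
      _ = _ := by rw [invScale]; ring

/-! ### Modular estimates on Orlicz spaces -/

/-- The weak modular inequality for `M_ρ`. -/
lemma map_mul_volume_lt_fracMaximal_le (hn : 0 < n) (hΦ : IsYoung Φ) {ρ : ℝ≥0 → ℝ≥0}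
    (hρ : MonotoneOn ρ (Ioi 0)) {C : ℝ≥0∞}
    (hC : ∀ r : ℝ≥0, 0 < r → (ρ r : ℝ≥0∞) ≤ C * (invScale n Ψ r / invScale n Φ r))
    {g : EuclideanSpace ℝ (Fin n) → ℝ≥0∞} (hg : ∫⁻ y, Φ (g y) ≤ 1) (c : ℝ≥0∞) :
    Ψ c * volume {x | 2 * volConst n * C * c < fracMaximal ρ g x} ≤ 5 ^ n := by
  -- Working with every `s < Ψ(c)` gives `Ψ⁻¹(s) ≤ c`, and also covers `Ψ(c) = ∞`.
  refine ENNReal.mul_le_of_forall_lt fun s hs b hb => ?_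
  rcases eq_or_ne s 0 with rfl | hs0
  · simp
  have hs' : s ≠ ∞ := hs.ne_top
  have hsub : {x | 2 * volConst n * C * c < fracMaximal ρ g x} ⊆
      maximalSuperlevel s fun y => Φ (g y) := by
    intro x hx
    by_contra hx'
    simp only [maximalSuperlevel, mem_ofPred_eq, not_exists, not_and, not_lt] at hx'
    refine absurd (show 2 * volConst n * C * c < fracMaximal ρ g x from hx) (not_lt.2 ?_)
    refine (fracMaximal_le_youngInv hn hΦ hρ hC hg hs0 hs' fun t ht => ?_).trans
      (mul_le_mul_right (youngInv_le_of_lt hs) _)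
    simpa using hΦ.lintegral_le_of_lintegral_map_le
      (μ := volume.restrict (Metric.ball x (t : ℝ))) hs0 hs' (by simpa using hx' t ht)
  calc s * b ≤ s * volume (maximalSuperlevel s fun y => Φ (g y)) := by
        gcongr; exact hb.le.trans (measure_mono hsub)
    _ ≤ 5 ^ n * ∫⁻ y, Φ (g y) := mul_volume_maximalSuperlevel_le hn hs0 hs' _
    _ ≤ 5 ^ n * 1 := by gcongr
    _ = 5 ^ n := mul_one _

/-- Pointwise domination of `M_ρ` by the Hardy-Littlewood maximal operator. -/
lemma map_fracMaximal_le (hn : 0 < n) (hΦ : IsYoung Φ) (hΨ : IsYoung Ψ) {ρ : ℝ≥0 → ℝ≥0}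
    (hρ : MonotoneOn ρ (Ioi 0)) {C : ℝ≥0∞}
    (hC : ∀ r : ℝ≥0, 0 < r → (ρ r : ℝ≥0∞) ≤ C * (invScale n Ψ r / invScale n Φ r))
    {g : EuclideanSpace ℝ (Fin n) → ℝ≥0∞} (hg : ∫⁻ y, Φ (g y) ≤ 1)
    (x : EuclideanSpace ℝ (Fin n)) :
    Ψ (fracMaximal ρ g x / (2 * volConst n * C) / 2) ≤ Φ (fracMaximal (fun _ => 1) g x) := by
  refine hΨ.map_half_le fun s hs hs' hle => ENNReal.div_le_of_le_mul' ?_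
  refine fracMaximal_le_youngInv hn hΦ hρ hC hg hs hs' fun t ht => ?_
  -- Here the averages of `g` are bounded by `Mg(x) ≤ Φ⁻¹(s)` directly, with no appeal to Jensen.
  have h := (le_fracMaximal (fun _ => 1) g x ht).trans (hΦ.le_youngInv hle)
  rw [ENNReal.coe_one, one_div, mul_comm, ← div_eq_mul_inv,
    ENNReal.div_le_iff (volume_ball_ne_zero x ht) measure_ball_lt_top.ne] at h
  refine h.trans ?_
  gcongr
  exact le_mul_of_one_le_left zero_le one_le_two

/-- The part of `g` not exceeding `a` contributes at most `a` to any average, so an average above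
`2a` leaves more than `a` for the truncated part. -/
lemma setOf_lt_fracMaximal_one_subset (g : EuclideanSpace ℝ (Fin n) → ℝ≥0∞) (a : ℝ≥0) :
    {x | 2 * (a : ℝ≥0∞) < fracMaximal (fun _ => 1) g x} ⊆
      maximalSuperlevel a fun y => if (a : ℝ≥0∞) < g y then g y else 0 := by
  intro x hx
  have hx : 2 * (a : ℝ≥0∞) < fracMaximal (fun _ => 1) g x := hx
  rw [← not_le, fracMaximal_le_iff] at hx
  push Not at hx
  obtain ⟨t, ht, h⟩ := hx
  refine ⟨t, ht, ?_⟩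
  rw [ENNReal.coe_one, one_div, mul_comm (volume _)⁻¹, ← div_eq_mul_inv,
    ENNReal.lt_div_iff_mul_lt (Or.inl (volume_ball_ne_zero x ht))
      (Or.inl measure_ball_lt_top.ne)] at h
  have hfin : a * volume (Metric.ball x (t : ℝ)) ≠ ∞ :=
    ENNReal.mul_ne_top ENNReal.coe_ne_top measure_ball_lt_top.ne
  have h2 : ∫⁻ y in Metric.ball x (t : ℝ), g y ≤ a * volume (Metric.ball x (t : ℝ)) +
      ∫⁻ y in Metric.ball x (t : ℝ), if (a : ℝ≥0∞) < g y then g y else 0 := by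
    rw [← setLIntegral_const, ← lintegral_add_left measurable_const]
    refine lintegral_mono fun y => ?_
    show g y ≤ a + if (a : ℝ≥0∞) < g y then g y else 0
    split_ifs with hy
    · exact le_add_self
    · rw [add_zero]; exact not_lt.1 hy
  have h3 := h.trans_le h2
  rw [two_mul, add_mul] at h3
  exact (ENNReal.add_lt_add_iff_left hfin).1 h3

lemma map_le_of_nabla2 {K : ℝ≥0}
    (h : ∀ r : ℝ≥0, Φ r ≤ (2 * (K : ℝ≥0∞))⁻¹ * Φ (K * r)) (i : ℕ) (r : ℝ≥0) :
    Φ r ≤ ((2 * (K : ℝ≥0∞))⁻¹) ^ i * Φ ((K ^ i * r : ℝ≥0)) := by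
  induction i with
  | zero => simp
  | succ i ih =>
    refine ih.trans ?_
    rw [pow_succ, mul_assoc]
    refine mul_le_mul_right ((h _).trans_eq ?_) _
    rw [← ENNReal.coe_mul]
    congr 3
    ring

/-- A discrete layer-cake bound in powers of `K`. For `0 < m < ∞` the single index with `K^j < m / 2
≤ K^(j+1)` suffices; `m = ∞` is approached through finite `r`. -/
lemma map_le_tsum (hΦ : IsYoung Φ) {K : ℝ≥0} (hK : 1 < K) (m : ℝ≥0∞) :
    Φ m ≤ ∑' j : ℤ, if 2 * ((K ^ j : ℝ≥0) : ℝ≥0∞) < m then Φ (2 * K * (K ^ j : ℝ≥0)) else 0 := by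
  have key : ∀ r : ℝ≥0, 0 < r → (r : ℝ≥0∞) ≤ m → Φ r ≤
      ∑' j : ℤ, if 2 * ((K ^ j : ℝ≥0) : ℝ≥0∞) < m then Φ (2 * K * (K ^ j : ℝ≥0)) else 0 := by
    intro r hr hrm
    obtain ⟨j, hj, hj'⟩ := exists_mem_Ioc_zpow (half_pos hr) hK
    refine le_trans ?_ (ENNReal.le_tsum j)
    have h1 : 2 * K ^ j < r := by
      rw [lt_div_iff₀ two_pos] at hj
      rwa [mul_comm]
    rw [if_pos (lt_of_lt_of_le (by exact_mod_cast h1) hrm)]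
    refine hΦ.monotone ?_
    have h2 : r ≤ 2 * K * K ^ j := by
      rw [div_le_iff₀ two_pos, zpow_add_one₀ (zero_lt_one.trans hK).ne'] at hj'
      exact hj'.trans_eq (by ring)
    exact_mod_cast h2
  rcases eq_or_ne m ∞ with rfl | hm
  · refine le_of_forall_lt fun s hs => ?_
    obtain ⟨r, hr, hsr⟩ := hΦ.exists_lt_map (hs.ne_top)
    lift r to ℝ≥0 using hr
    refine hsr.trans_le (key r (pos_iff_ne_zero.2 ?_) le_top)
    rintro rfl
    simp [hΦ.map_zero] at hsr
  · lift m to ℝ≥0 using hm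
    rcases eq_or_ne m 0 with rfl | hm0
    · simp [hΦ.map_zero]
    · exact key m (pos_iff_ne_zero.2 hm0) le_rfl

/-- If `K^J < u ≤ K^(J+1)`, only indices `j = J - i` with `i ≥ 0` contribute. Iterating `∇₂` gains
`(2K)⁻ⁱ`, whereas `u / K^j` costs at most `K^(i+1)`. The product decays like `2⁻ⁱ`, so the series
converges to the stated constant. -/
lemma tsum_le_of_nabla2 (hΦ : IsYoung Φ) {K : ℝ≥0} (hK : 1 < K)
    (h : ∀ r : ℝ≥0, Φ r ≤ (2 * (K : ℝ≥0∞))⁻¹ * Φ (K * r)) (u : ℝ≥0∞) :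
    ∑' j : ℤ, Φ (2 * K * (K ^ j : ℝ≥0)) * (((K ^ j : ℝ≥0) : ℝ≥0∞)⁻¹ *
      if ((K ^ j : ℝ≥0) : ℝ≥0∞) < u then u else 0) ≤ 2 * K * Φ (2 * K * u) := by
  have hK0 : K ≠ 0 := (zero_lt_one.trans hK).ne'
  have hKe : (K : ℝ≥0∞) ≠ 0 := by exact_mod_cast hK0
  rcases eq_or_ne u ∞ with rfl | hu
  · rw [ENNReal.mul_top (by simp [hK0]), hΦ.map_top, ENNReal.mul_top (by simp [hK0])]
    exact le_top
  lift u to ℝ≥0 using hu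
  rcases eq_or_ne u 0 with rfl | hu0
  · simp
  obtain ⟨J, hJ, hJ'⟩ := exists_mem_Ioc_zpow (pos_iff_ne_zero.2 hu0) hK
  have hinj : Function.Injective fun i : ℕ => J - (i : ℤ) := fun a b hab => by
    simpa using hab
  rw [← hinj.tsum_eq]
  · calc _ ≤ ∑' i : ℕ, (2⁻¹ : ℝ≥0∞) ^ i * (K * Φ (2 * K * u)) := by
          refine ENNReal.tsum_le_tsum fun i => ?_
          have hz : K ^ (J - (i : ℤ)) ≠ 0 := zpow_ne_zero _ hK0
          have hzi : K ^ i * K ^ (J - (i : ℤ)) = K ^ J := by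
            rw [← zpow_natCast, ← zpow_add₀ hK0]; congr 1; ring
          have h1 : Φ (2 * K * (K ^ (J - (i : ℤ)) : ℝ≥0)) ≤
              ((2 * (K : ℝ≥0∞))⁻¹) ^ i * Φ (2 * K * u) := by
            have := map_le_of_nabla2 h i (2 * K * K ^ (J - (i : ℤ)))
            rw [mul_left_comm, hzi] at this
            push_cast at this ⊢
            refine this.trans (mul_le_mul_right (hΦ.monotone ?_) _)
            gcongr
          have h2 : ((K ^ (J - (i : ℤ)) : ℝ≥0) : ℝ≥0∞)⁻¹ *
              (if ((K ^ (J - (i : ℤ)) : ℝ≥0) : ℝ≥0∞) < u then (u : ℝ≥0∞) else 0) ≤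
              (K : ℝ≥0∞) ^ i * K := by
            calc _ ≤ ((K ^ (J - (i : ℤ)) : ℝ≥0) : ℝ≥0∞)⁻¹ * u := by
                  gcongr; split_ifs <;> simp
              _ ≤ (K : ℝ≥0∞) ^ i * K := by
                  rw [← ENNReal.coe_inv hz, ← ENNReal.coe_mul, ← ENNReal.coe_pow,
                    ← ENNReal.coe_mul, ENNReal.coe_le_coe,
                    inv_mul_le_iff₀ (pos_iff_ne_zero.2 hz)]
                  refine hJ'.trans_eq ?_
                  rw [zpow_add_one₀ hK0, ← hzi]; ring
          calc _ ≤ ((2 * (K : ℝ≥0∞))⁻¹) ^ i * Φ (2 * K * u) * ((K : ℝ≥0∞) ^ i * K) := by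
                gcongr
            _ = ((2 * (K : ℝ≥0∞))⁻¹ * K) ^ i * (K * Φ (2 * K * u)) := by
                rw [mul_pow]; ring
            _ = _ := by
                rw [ENNReal.mul_inv (by simp) (by simp), mul_assoc,
                  ENNReal.inv_mul_cancel hKe ENNReal.coe_ne_top, mul_one]
      _ = 2 * K * Φ (2 * K * u) := by
          rw [ENNReal.tsum_mul_right, ENNReal.tsum_geometric, ENNReal.one_sub_inv_two, inv_inv,
            ← mul_assoc]
  · intro j hj
    rw [Function.mem_support] at hj
    have hju : K ^ j < u := by
      by_contra hcon
      exact hj (by rw [if_neg (by exact_mod_cast hcon)]; simp)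
    have hjJ : j < J + 1 := (zpow_lt_zpow_iff_right₀ hK).1 (hju.trans_le hJ')
    exact ⟨(J - j).toNat, by
      show J - ((J - j).toNat : ℤ) = j
      omega⟩

/-- The modular inequality for the Hardy-Littlewood maximal operator under `∇₂`. -/
lemma exists_lintegral_map_maximal_le (hn : 0 < n) (hΦ : IsYoung Φ) (h : Nabla2 Φ) :
    ∃ A : ℝ≥0, 1 ≤ A ∧ ∀ g : EuclideanSpace ℝ (Fin n) → ℝ≥0∞, AEMeasurable g →
      ∫⁻ y, Φ (g y) ≤ 1 →
        ∫⁻ x, Φ (fracMaximal (fun _ => 1) (fun y => (A : ℝ≥0∞)⁻¹ * g y) x) ≤ 1 := by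
  obtain ⟨K, hK, hKΦ⟩ := h
  have hK0 : K ≠ 0 := (zero_lt_one.trans hK).ne'
  -- Layer-cake in powers of `K`, the weak type bound for the truncation of `g` at each level, then
  -- summation under the integral.
  have main : ∀ g : EuclideanSpace ℝ (Fin n) → ℝ≥0∞, AEMeasurable g →
      ∫⁻ x, Φ (fracMaximal (fun _ => 1) g x) ≤
        5 ^ n * (2 * K * ∫⁻ x, Φ (2 * K * g x)) := by
    intro g hg
    have hm : ∀ j : ℤ, MeasurableSet
        {x | 2 * ((K ^ j : ℝ≥0) : ℝ≥0∞) < fracMaximal (fun _ => 1) g x} := fun j =>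
      measurableSet_lt measurable_const (measurable_fracMaximal _ g)
    have hgm : ∀ j : ℤ, AEMeasurable fun y =>
        if ((K ^ j : ℝ≥0) : ℝ≥0∞) < g y then g y else 0 := fun j => by
      have : Measurable fun u : ℝ≥0∞ => if ((K ^ j : ℝ≥0) : ℝ≥0∞) < u then u else 0 :=
        Measurable.ite measurableSet_Ioi measurable_id measurable_const
      exact this.comp_aemeasurable hg
    calc ∫⁻ x, Φ (fracMaximal (fun _ => 1) g x)
        ≤ ∫⁻ x, ∑' j : ℤ,
            {x | 2 * ((K ^ j : ℝ≥0) : ℝ≥0∞) < fracMaximal (fun _ => 1) g x}.indicator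
              (fun _ => Φ (2 * K * (K ^ j : ℝ≥0))) x := by
          refine lintegral_mono fun x => (map_le_tsum hΦ hK _).trans_eq ?_
          simp only [indicator_apply, mem_ofPred_eq]
      _ = ∑' j : ℤ, Φ (2 * K * (K ^ j : ℝ≥0)) *
            volume {x | 2 * ((K ^ j : ℝ≥0) : ℝ≥0∞) < fracMaximal (fun _ => 1) g x} := by
          rw [lintegral_tsum fun j => (measurable_const.indicator (hm j)).aemeasurable]
          simp_rw [lintegral_indicator_const (hm _)]
      _ ≤ ∑' j : ℤ, Φ (2 * K * (K ^ j : ℝ≥0)) * (((K ^ j : ℝ≥0) : ℝ≥0∞)⁻¹ *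
            (5 ^ n * ∫⁻ y, if ((K ^ j : ℝ≥0) : ℝ≥0∞) < g y then g y else 0)) := by
          refine ENNReal.tsum_le_tsum fun j => ?_
          have hz : ((K ^ j : ℝ≥0) : ℝ≥0∞) ≠ 0 := by
            exact_mod_cast zpow_ne_zero j hK0
          gcongr
          rw [mul_comm _⁻¹, ← div_eq_mul_inv, ENNReal.le_div_iff_mul_le (Or.inl hz)
            (Or.inl ENNReal.coe_ne_top), mul_comm (volume _)]
          refine le_trans ?_ (mul_volume_maximalSuperlevel_le hn hz ENNReal.coe_ne_top _)
          gcongr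
          exact setOf_lt_fracMaximal_one_subset g _
      _ = 5 ^ n * ∑' j : ℤ, ∫⁻ y, Φ (2 * K * (K ^ j : ℝ≥0)) * (((K ^ j : ℝ≥0) : ℝ≥0∞)⁻¹ *
            if ((K ^ j : ℝ≥0) : ℝ≥0∞) < g y then g y else 0) := by
          rw [← ENNReal.tsum_mul_left]
          congr 1
          ext j
          rw [lintegral_const_mul'' _ ((hgm j).const_mul _), lintegral_const_mul'' _ (hgm j)]
          ring
      _ = 5 ^ n * ∫⁻ y, ∑' j : ℤ, Φ (2 * K * (K ^ j : ℝ≥0)) * (((K ^ j : ℝ≥0) : ℝ≥0∞)⁻¹ *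
            if ((K ^ j : ℝ≥0) : ℝ≥0∞) < g y then g y else 0) := by
          rw [lintegral_tsum fun j => ((hgm j).const_mul _).const_mul _]
      _ ≤ 5 ^ n * ∫⁻ y, 2 * K * Φ (2 * K * g y) := by
          gcongr with y
          exact tsum_le_of_nabla2 hΦ hK hKΦ (g y)
      _ = _ := by
          rw [lintegral_const_mul' _ _ (by finiteness)]
  have h1 : (1 : ℝ≥0) ≤ 5 ^ n * (2 * K) :=
    one_le_mul (one_le_pow₀ (by norm_num)) (one_le_mul one_le_two hK.le)
  -- The last factor `2K` undoes the dilation inside `Φ`; the remaining `5ⁿ · 2K` cancels the outer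
  -- constant by convexity.
  refine ⟨5 ^ n * (2 * K) * (2 * K), one_le_mul h1 (one_le_mul one_le_two hK.le),
    fun g hg hg1 => ?_⟩
  refine (main _ (hg.const_mul _)).trans ?_
  set A : ℝ≥0∞ := 5 ^ n * (2 * K) with hA
  have hA1 : 1 ≤ A := by rw [hA]; exact_mod_cast h1
  have hA0 : A ≠ 0 := (zero_lt_one.trans_le hA1).ne'
  have hA' : A ≠ ∞ := by rw [hA]; finiteness
  have hc : ((5 ^ n * (2 * K) * (2 * K) : ℝ≥0) : ℝ≥0∞) = A * (2 * K) := by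
    rw [hA]; push_cast; ring
  have h2K : (2 * K : ℝ≥0∞) ≠ 0 := by simp [hK0]
  have h2K' : (2 * K : ℝ≥0∞) ≠ ∞ := by finiteness
  rw [← mul_assoc, ← hA]
  calc A * ∫⁻ x, Φ (2 * K * (((5 ^ n * (2 * K) * (2 * K) : ℝ≥0) : ℝ≥0∞)⁻¹ * g x))
      = A * ∫⁻ x, Φ (A⁻¹ * g x) := by
        congr 2
        ext x
        rw [hc, ENNReal.mul_inv (Or.inl hA0) (Or.inl hA'), ← mul_assoc, mul_left_comm,
          ENNReal.mul_inv_cancel h2K h2K', mul_one]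
    _ ≤ A * ∫⁻ x, A⁻¹ * Φ (g x) := by
        gcongr with x
        exact hΦ.map_mul_le (ENNReal.inv_le_one.2 hA1) _
    _ = ∫⁻ x, Φ (g x) := by
        rw [lintegral_const_mul' _ _ (ENNReal.inv_ne_top.2 hA0), ← mul_assoc,
          ENNReal.mul_inv_cancel hA0 hA', one_mul]
    _ ≤ 1 := hg1

/-! ### Luxemburg norms -/

/-- Replaces attainment of the infimum in the Luxemburg norm. `C ≠ 0` matters when `m = ∞`, since no
`L` is then available; later constants are kept nonzero for this reason. -/
lemma le_mul_of_forall_lt {X m C : ℝ≥0∞} (hC0 : C ≠ 0) (hC : C ≠ ∞)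
    (h : ∀ L : ℝ≥0, m < L → X ≤ C * L) : X ≤ C * m := by
  rw [← ENNReal.inv_mul_le_iff hC0 hC]
  refine le_of_forall_gt_imp_ge_of_dense fun L hL => ?_
  rcases eq_or_ne L ∞ with rfl | hL'
  · exact le_top
  lift L to ℝ≥0 using hL'
  exact (ENNReal.inv_mul_le_iff hC0 hC).2 (h L hL)

section

variable {ε ε' : Type*} [TopologicalSpace ε] [ESeminormedAddMonoid ε]
  [TopologicalSpace ε'] [ESeminormedAddMonoid ε']

lemma luxNorm_le {f : EuclideanSpace ℝ (Fin n) → ε} {c : ℝ≥0∞} (hc : c ≠ 0)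
    (h : ∫⁻ x, Φ (‖f x‖ₑ / c) ≤ 1) : luxNorm Φ f ≤ c := by
  rcases eq_or_ne c ∞ with rfl | hc'
  · exact le_top
  lift c to ℝ≥0 using hc'
  exact iInf₂_le_of_le c (pos_iff_ne_zero.2 (by simpa using hc)) (iInf_le_of_le h le_rfl)

lemma IsYoung.lintegral_le_one_of_luxNorm_lt (hΦ : IsYoung Φ)
    {f : EuclideanSpace ℝ (Fin n) → ε} {c : ℝ≥0} (h : luxNorm Φ f < c) :
    ∫⁻ x, Φ (‖f x‖ₑ / c) ≤ 1 := by
  simp only [luxNorm, iInf_lt_iff] at h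
  obtain ⟨b, hb, hb1, hbc⟩ := h
  refine (lintegral_mono fun x => hΦ.monotone ?_).trans hb1
  gcongr

lemma IsYoung.luxNorm_mono (hΦ : IsYoung Φ) {f : EuclideanSpace ℝ (Fin n) → ε}
    {g : EuclideanSpace ℝ (Fin n) → ε'} (h : ∀ x, ‖f x‖ₑ ≤ ‖g x‖ₑ) :
    luxNorm Φ f ≤ luxNorm Φ g := by
  refine le_iInf₂ fun c hc => le_iInf fun h1 => luxNorm_le (by simpa using hc.ne') ?_
  refine (lintegral_mono fun x => hΦ.monotone ?_).trans h1
  gcongr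
  exact h x

lemma luxNorm_enorm (f : EuclideanSpace ℝ (Fin n) → ε) :
    luxNorm Φ (fun x => ‖f x‖ₑ) = luxNorm Φ f := by
  simp only [luxNorm, enorm_eq_self]

lemma morreyNorm_enorm (φ : ℝ≥0 → ℝ≥0) (f : EuclideanSpace ℝ (Fin n) → ε) :
    morreyNorm Φ φ (fun x => ‖f x‖ₑ) = morreyNorm Φ φ f := by
  simp only [morreyNorm, luxNorm, enorm_indicator_eq_indicator_enorm, enorm_eq_self]

lemma IsYoung.weakLuxNorm_le_luxNorm (hΦ : IsYoung Φ) (f : EuclideanSpace ℝ (Fin n) → ε) :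
    weakLuxNorm Φ f ≤ luxNorm Φ f := by
  refine iSup₂_le fun c _ => hΦ.luxNorm_mono fun x => ?_
  rw [enorm_eq_self, indicator_apply]
  split_ifs with hx
  · exact le_of_lt hx
  · exact zero_le

end

lemma IsYoung.luxNorm_indicator_const_le (hΦ : IsYoung Φ) {S : Set (EuclideanSpace ℝ (Fin n))}
    {c b : ℝ≥0∞} (hb : b ≠ 0) (h : Φ (c / b) * volume S ≤ 1) :
    luxNorm Φ (S.indicator fun _ => c) ≤ b := by
  refine luxNorm_le hb ?_
  calc ∫⁻ x, Φ (‖S.indicator (fun _ => c) x‖ₑ / b)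
      = ∫⁻ x, S.indicator (fun _ => Φ (c / b)) x := by
        congr 1
        ext x
        rw [enorm_eq_self]
        by_cases hx : x ∈ S <;> simp [hx, hΦ.map_zero]
    _ ≤ Φ (c / b) * volume S := lintegral_indicator_const_le _ _
    _ ≤ 1 := h

/-- With `le_luxNorm_ball_const`, this says that `‖χ_B‖` is comparable to `1 / Φ⁻¹(r⁻ⁿ)`. In the
constant, the `2` moves strictly below `Φ⁻¹(r⁻ⁿ)` and `volConst n` absorbs the volume of the unit
ball. -/
lemma IsYoung.luxNorm_ball_const_le (hΦ : IsYoung Φ) (x : EuclideanSpace ℝ (Fin n)) {r : ℝ≥0}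
    (hr : 0 < r) {c : ℝ≥0∞} (hc : c ≠ 0) (hc' : c ≠ ∞) :
    luxNorm Φ ((Metric.ball x (r : ℝ)).indicator fun _ => c) ≤
      2 * volConst n * c / invScale n Φ r := by
  have hI := hΦ.invScale_ne_zero (n := n) r
  have hI' := hΦ.invScale_ne_top (n := n) hr
  have hκ : (2 * volConst n : ℝ≥0∞) ≠ 0 := mul_ne_zero two_ne_zero volConst_ne_zero
  have hκ' : (2 * volConst n : ℝ≥0∞) ≠ ∞ := ENNReal.mul_ne_top (by simp) volConst_ne_top
  refine hΦ.luxNorm_indicator_const_le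
    (ENNReal.div_ne_zero.2 ⟨mul_ne_zero hκ hc, hI'⟩) ?_
  have h1 : c / (2 * volConst n * c / invScale n Φ r) =
      (volConst n)⁻¹ * (invScale n Φ r / 2) := by
    simp only [div_eq_mul_inv]
    rw [ENNReal.mul_inv (Or.inr (ENNReal.inv_ne_top.2 hI)) (Or.inr (ENNReal.inv_ne_zero.2 hI')),
      inv_inv, ENNReal.mul_inv (Or.inl hκ) (Or.inl hκ'),
      ENNReal.mul_inv (Or.inl two_ne_zero) (Or.inl (by simp))]
    calc c * (2⁻¹ * (volConst n)⁻¹ * c⁻¹ * invScale n Φ r)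
        = c * c⁻¹ * ((volConst n)⁻¹ * (invScale n Φ r * 2⁻¹)) := by ring
      _ = _ := by rw [ENNReal.mul_inv_cancel hc hc', one_mul]
  calc Φ (c / (2 * volConst n * c / invScale n Φ r)) * volume (Metric.ball x (r : ℝ))
      ≤ (volConst n)⁻¹ * Φ (invScale n Φ r / 2) * volume (Metric.ball x (r : ℝ)) := by
        rw [h1]
        gcongr
        exact hΦ.map_mul_le (ENNReal.inv_le_one.2 one_le_volConst) _
    _ ≤ (volConst n)⁻¹ * ((r : ℝ≥0∞) ^ n)⁻¹ * volume (Metric.ball x (r : ℝ)) := by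
        gcongr
        exact map_le_of_lt_youngInv (ENNReal.half_lt_self hI hI')
    _ ≤ (volConst n)⁻¹ * volConst n := by
        rw [mul_assoc]; gcongr; exact inv_pow_mul_volume_ball_le x hr
    _ = 1 := ENNReal.inv_mul_cancel volConst_ne_zero volConst_ne_top

lemma IsYoung.le_luxNorm_ball_const (hΦ : IsYoung Φ) (x : EuclideanSpace ℝ (Fin n)) {r : ℝ≥0}
    (hr : 0 < r) (c : ℝ≥0∞) :
    c ≤ volConst n * invScale n Φ r *
      luxNorm Φ ((Metric.ball x (r : ℝ)).indicator fun _ => c) := by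
  have hI := hΦ.invScale_ne_zero (n := n) r
  have hI' := hΦ.invScale_ne_top (n := n) hr
  refine le_mul_of_forall_lt (mul_ne_zero volConst_ne_zero hI)
    (ENNReal.mul_ne_top volConst_ne_top hI') fun L hL => ?_
  have h := hΦ.lintegral_le_one_of_luxNorm_lt hL
  have h1 : Φ (c / L) * volume (Metric.ball x (r : ℝ)) ≤ 1 := by
    rw [← setLIntegral_const]
    refine le_trans ?_ h
    rw [← lintegral_indicator Metric.isOpen_ball.measurableSet]
    refine lintegral_mono fun y => ?_
    rw [enorm_eq_self]
    by_cases hy : y ∈ Metric.ball x (r : ℝ) <;> simp [hy]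
  have hL0 : (L : ℝ≥0∞) ≠ 0 := (zero_le.trans_lt hL).ne'
  rw [← ENNReal.div_le_iff hL0 ENNReal.coe_ne_top]
  refine (hΦ.le_youngInv ?_).trans (hΦ.youngInv_inv_volume_ball_le x hr)
  rwa [← one_div, ENNReal.le_div_iff_mul_le (Or.inl (volume_ball_ne_zero x hr))
    (Or.inl measure_ball_lt_top.ne)]

/-- Dividing by `2(a + b)` instead of `a` or `b` halves each modular by convexity, so the two
together stay at most `1`. -/
lemma IsYoung.luxNorm_le_of_le_max (hΦ : IsYoung Φ)
    {F G H : EuclideanSpace ℝ (Fin n) → ℝ≥0∞} (hG : Measurable G)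
    (h : ∀ x, F x ≤ max (G x) (H x)) :
    luxNorm Φ F ≤ 2 * (luxNorm Φ G + luxNorm Φ H) := by
  have key : ∀ a b : ℝ≥0, luxNorm Φ G < a → luxNorm Φ H < b →
      luxNorm Φ F ≤ 2 * ((a : ℝ≥0∞) + b) := by
    intro a b ha hb
    have ha' := hΦ.lintegral_le_one_of_luxNorm_lt ha
    have hb' := hΦ.lintegral_le_one_of_luxNorm_lt hb
    have ha0 : (a : ℝ≥0∞) ≠ 0 := (zero_le.trans_lt ha).ne'
    have hhalf : ∀ u : ℝ≥0∞, ∀ d : ℝ≥0, (d : ℝ≥0∞) ≤ a + b →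
        Φ (u / (2 * ((a : ℝ≥0∞) + b))) ≤ 2⁻¹ * Φ (u / d) := by
      intro u d hd
      calc Φ (u / (2 * ((a : ℝ≥0∞) + b))) ≤ Φ (2⁻¹ * (u / d)) := by
            refine hΦ.monotone ?_
            calc u / (2 * ((a : ℝ≥0∞) + b)) ≤ u / (2 * d) := by gcongr
              _ = 2⁻¹ * (u / d) := by
                  simp only [div_eq_mul_inv]
                  rw [ENNReal.mul_inv (by simp) (by simp)]
                  ring
        _ ≤ _ := hΦ.map_mul_le (by simp) _
    refine luxNorm_le (by simp [ha0]) ?_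
    simp only [enorm_eq_self] at ha' hb' ⊢
    calc ∫⁻ x, Φ (F x / (2 * ((a : ℝ≥0∞) + b)))
        ≤ ∫⁻ x, (2⁻¹ * Φ (G x / a) + 2⁻¹ * Φ (H x / b)) := by
          refine lintegral_mono fun x => ?_
          rcases le_max_iff.1 (h x) with hx | hx
          · refine le_trans ?_ le_self_add
            refine le_trans (hΦ.monotone ?_) (hhalf (G x) a le_self_add)
            gcongr
          · refine le_trans ?_ le_add_self
            refine le_trans (hΦ.monotone ?_) (hhalf (H x) b le_add_self)
            gcongr
      _ = (2⁻¹ * ∫⁻ x, Φ (G x / a)) + 2⁻¹ * ∫⁻ x, Φ (H x / b) := by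
          have hm : Measurable fun x => 2⁻¹ * Φ (G x / a) :=
            (hΦ.measurable.comp (hG.div_const _)).const_mul _
          rw [lintegral_add_left hm, lintegral_const_mul' _ _ (by simp), lintegral_const_mul' _ _ (by simp)]
      _ ≤ 2⁻¹ * 1 + 2⁻¹ * 1 := add_le_add (mul_le_mul_right ha' _) (mul_le_mul_right hb' _)
      _ = 1 := by rw [mul_one, ENNReal.inv_two_add_inv_two]
  -- Any `L` above the sum of the two norms splits as `a + (L - a)` with each part strictly above
  -- its own norm.
  refine le_mul_of_forall_lt two_ne_zero ENNReal.ofNat_ne_top fun L hL => ?_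
  have h0 : luxNorm Φ G < L - luxNorm Φ H := lt_tsub_iff_right.2 hL
  obtain ⟨a, ha, haL⟩ := ENNReal.lt_iff_exists_nnreal_btwn.1 h0
  have h1 : luxNorm Φ H < L - a := lt_tsub_iff_left.2 (lt_tsub_iff_right.1 haL)
  have h2 := key a (L - a) ha (by rwa [ENNReal.coe_sub])
  rwa [← ENNReal.coe_add, add_tsub_cancel_of_le] at h2
  exact_mod_cast (haL.trans_le tsub_le_self).le

lemma IsYoung.weakLuxNorm_le_of_le_max (hΦ : IsYoung Φ)
    {F G H : EuclideanSpace ℝ (Fin n) → ℝ≥0∞} (hG : Measurable G)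
    (h : ∀ x, F x ≤ max (G x) (H x)) :
    weakLuxNorm Φ F ≤ 2 * (weakLuxNorm Φ G + weakLuxNorm Φ H) := by
  refine iSup₂_le fun c hc => ?_
  calc luxNorm Φ ({x | (c : ℝ≥0∞) < ‖F x‖ₑ}.indicator fun _ => (c : ℝ≥0∞))
      ≤ 2 * (luxNorm Φ ({x | (c : ℝ≥0∞) < ‖G x‖ₑ}.indicator fun _ => (c : ℝ≥0∞)) +
          luxNorm Φ ({x | (c : ℝ≥0∞) < ‖H x‖ₑ}.indicator fun _ => (c : ℝ≥0∞))) := by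
        refine hΦ.luxNorm_le_of_le_max
          (measurable_const.indicator (measurableSet_lt measurable_const hG.enorm)) fun x => ?_
        simp only [enorm_eq_self, indicator_apply, mem_ofPred_eq]
        split_ifs with h1 h2 h3 h4 <;> simp
        rcases lt_max_iff.1 (h1.trans_le (h x)) with h5 | h5
        · exact absurd h5 h2
        · exact absurd h5 h4
    _ ≤ _ := by
        gcongr
        · exact le_iSup₂_of_le c hc le_rfl
        · exact le_iSup₂_of_le c hc le_rfl

/-- The embedding of `L^Φ` into `L¹` on a ball. -/
lemma IsYoung.setLIntegral_ball_le_luxNorm (hΦ : IsYoung Φ)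
    (f : EuclideanSpace ℝ (Fin n) → ℝ≥0∞) (x : EuclideanSpace ℝ (Fin n)) {r : ℝ≥0}
    (hr : 0 < r) :
    ∫⁻ y in Metric.ball x (r : ℝ), f y ≤
      2 * (volConst n * invScale n Φ r) * volume (Metric.ball x (r : ℝ)) *
        luxNorm Φ ((Metric.ball x (r : ℝ)).indicator f) := by
  have hI := hΦ.invScale_ne_zero (n := n) r
  have hI' := hΦ.invScale_ne_top (n := n) hr
  have h0 := volume_ball_ne_zero x hr
  have h1 : volume (Metric.ball x (r : ℝ)) ≠ ∞ := measure_ball_lt_top.ne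
  have hκ := volConst_ne_zero (n := n)
  have hκ' := volConst_ne_top (n := n)
  refine le_mul_of_forall_lt (by simp [hκ, hI, h0]) (by finiteness) fun L hL => ?_
  have h := hΦ.lintegral_le_one_of_luxNorm_lt hL
  have hL0 : (L : ℝ≥0∞) ≠ 0 := (zero_le.trans_lt hL).ne'
  have h2 : ∫⁻ y in Metric.ball x (r : ℝ), Φ (f y / L) ≤ 1 := by
    refine le_trans ?_ h
    rw [← lintegral_indicator Metric.isOpen_ball.measurableSet]
    refine lintegral_mono fun y => ?_
    rw [enorm_eq_self]
    by_cases hy : y ∈ Metric.ball x (r : ℝ) <;> simp [hy]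
  have h3 := hΦ.setLIntegral_ball_le x hr h2
  simp only [div_eq_mul_inv] at h3
  rw [lintegral_mul_const' _ _ (ENNReal.inv_ne_top.2 hL0), ← div_eq_mul_inv,
    ENNReal.div_le_iff hL0 ENNReal.coe_ne_top] at h3
  exact h3

/-! ### Boundedness on Orlicz spaces -/

/-- The weak modular inequality made homogeneous: `g` is normalised by `L`, and convexity turns the
modular bound `5ⁿ` into `1` at the price of a factor `5ⁿ` in the norm. -/
lemma weakLuxNorm_fracMaximal_le (hn : 0 < n) (hΦ : IsYoung Φ) (hΨ : IsYoung Ψ)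
    {ρ : ℝ≥0 → ℝ≥0} (hρ : MonotoneOn ρ (Ioi 0)) {C : ℝ≥0∞} (hC0 : C ≠ 0) (hC' : C ≠ ∞)
    (hC : ∀ r : ℝ≥0, 0 < r → (ρ r : ℝ≥0∞) ≤ C * (invScale n Ψ r / invScale n Φ r))
    (g : EuclideanSpace ℝ (Fin n) → ℝ≥0∞) :
    weakLuxNorm Ψ (fracMaximal ρ g) ≤ 5 ^ n * (2 * volConst n * C) * luxNorm Φ g := by
  have hκ : 2 * volConst n * C ≠ 0 := by simp [volConst_ne_zero, hC0]
  have hκ' : 2 * volConst n * C ≠ ∞ := by have := volConst_ne_top (n := n); finiteness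
  have h5 : (5 ^ n : ℝ≥0∞) ≠ 0 := by simp
  refine le_mul_of_forall_lt (mul_ne_zero h5 hκ) (by finiteness) fun L hL => ?_
  have h := hΦ.lintegral_le_one_of_luxNorm_lt hL
  have hL0 : (L : ℝ≥0∞) ≠ 0 := (zero_le.trans_lt hL).ne'
  simp only [enorm_eq_self, ENNReal.div_eq_inv_mul] at h
  have hM := fracMaximal_const_mul ρ g (ENNReal.inv_ne_top.2 hL0)
  refine iSup₂_le fun c hc => ?_
  refine hΨ.luxNorm_indicator_const_le (mul_ne_zero (mul_ne_zero h5 hκ) hL0) ?_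
  set a : ℝ≥0∞ := (L : ℝ≥0∞)⁻¹ * ((2 * volConst n * C)⁻¹ * c) with ha
  have hweak := map_mul_volume_lt_fracMaximal_le hn hΦ hρ hC h a
  have hset : {x | (c : ℝ≥0∞) < ‖fracMaximal ρ g x‖ₑ} =
      {x | 2 * volConst n * C * a < fracMaximal ρ (fun y => (L : ℝ≥0∞)⁻¹ * g y) x} := by
    ext x
    rw [mem_ofPred_eq, mem_ofPred_eq, enorm_eq_self, hM, ha, mul_left_comm _ (L : ℝ≥0∞)⁻¹,
      ← mul_assoc _ _ (c : ℝ≥0∞), ENNReal.mul_inv_cancel hκ hκ', one_mul,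
      ENNReal.mul_lt_mul_iff_right (ENNReal.inv_ne_zero.2 ENNReal.coe_ne_top)
        (ENNReal.inv_ne_top.2 hL0)]
  have hca : c / (5 ^ n * (2 * volConst n * C) * L) = (5 ^ n)⁻¹ * a := by
    rw [ha, div_eq_mul_inv, ENNReal.mul_inv (Or.inr ENNReal.coe_ne_top) (Or.inr hL0),
      ENNReal.mul_inv (Or.inl h5) (Or.inl (by finiteness))]
    ring
  rw [hset, hca]
  calc _ ≤ (5 ^ n)⁻¹ * Ψ a *
        volume {x | 2 * volConst n * C * a < fracMaximal ρ (fun y => (L : ℝ≥0∞)⁻¹ * g y) x} := by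
        gcongr
        refine hΨ.map_mul_le (ENNReal.inv_le_one.2 (one_le_pow₀ (by norm_num))) _
    _ ≤ (5 ^ n)⁻¹ * 5 ^ n := by rw [mul_assoc]; gcongr
    _ = 1 := ENNReal.inv_mul_cancel h5 (by finiteness)

/-- The domination of `Ψ(M_ρ g / const)` by `Φ(Mg)` is combined with the modular inequality for `M`,
applied to `g` normalised by `L` and `A`. -/
lemma exists_luxNorm_fracMaximal_le (hn : 0 < n) (hΦ : IsYoung Φ) (hΨ : IsYoung Ψ)
    {ρ : ℝ≥0 → ℝ≥0} (hρ : MonotoneOn ρ (Ioi 0)) {C : ℝ≥0∞} (hC0 : C ≠ 0) (hC' : C ≠ ∞)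
    (hC : ∀ r : ℝ≥0, 0 < r → (ρ r : ℝ≥0∞) ≤ C * (invScale n Ψ r / invScale n Φ r))
    (h : Nabla2 Φ) :
    ∃ D : ℝ≥0∞, D ≠ ∞ ∧ ∀ g : EuclideanSpace ℝ (Fin n) → ℝ≥0∞, AEMeasurable g →
      luxNorm Ψ (fracMaximal ρ g) ≤ D * luxNorm Φ g := by
  obtain ⟨A, hA, hAg⟩ := exists_lintegral_map_maximal_le hn hΦ h
  have hA0 : (A : ℝ≥0∞) ≠ 0 := by exact_mod_cast (zero_lt_one.trans_le hA).ne'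
  have hκ : 2 * volConst n * C ≠ 0 := by simp [volConst_ne_zero, hC0]
  have hκ' : 2 * volConst n * C ≠ ∞ := by have := volConst_ne_top (n := n); finiteness
  refine ⟨2 * (2 * volConst n * C) * A, by finiteness, fun g hg => ?_⟩
  refine le_mul_of_forall_lt (mul_ne_zero (mul_ne_zero two_ne_zero hκ) hA0) (by finiteness)
    fun L hL => ?_
  have h := hΦ.lintegral_le_one_of_luxNorm_lt hL
  have hL0 : (L : ℝ≥0∞) ≠ 0 := (zero_le.trans_lt hL).ne'
  simp only [enorm_eq_self, ENNReal.div_eq_inv_mul] at h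
  have h1 := hAg _ (hg.const_mul _) h
  have h2 : ∫⁻ y, Φ ((A : ℝ≥0∞)⁻¹ * ((L : ℝ≥0∞)⁻¹ * g y)) ≤ 1 := by
    refine (lintegral_mono fun y => hΦ.monotone ?_).trans h
    exact mul_le_of_le_one_left zero_le (ENNReal.inv_le_one.2 (by exact_mod_cast hA))
  refine luxNorm_le (mul_ne_zero (mul_ne_zero (mul_ne_zero two_ne_zero hκ) hA0) hL0) ?_
  refine (lintegral_mono fun x => ?_).trans h1
  refine le_trans (le_of_eq ?_) (map_fracMaximal_le hn hΦ hΨ hρ hC h2 x)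
  rw [fracMaximal_const_mul _ _ (ENNReal.inv_ne_top.2 hA0),
    fracMaximal_const_mul _ _ (ENNReal.inv_ne_top.2 hL0), enorm_eq_self]
  congr 1
  simp only [div_eq_mul_inv]
  rw [ENNReal.mul_inv (Or.inr ENNReal.coe_ne_top) (Or.inr hL0),
    ENNReal.mul_inv (Or.inr ENNReal.coe_ne_top) (Or.inr hA0),
    ENNReal.mul_inv (Or.inl two_ne_zero) (Or.inl (by simp))]
  ring

variable {φ φ₁ φ₂ ρ : ℝ≥0 → ℝ≥0}

/-! ### Generalized Orlicz-Morrey spaces -/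

lemma GClass.coe_ne_zero (hφ : GClass n Φ φ) {r : ℝ≥0} (hr : 0 < r) : (φ r : ℝ≥0∞) ≠ 0 := by
  exact_mod_cast (hφ.pos r hr).ne'

/-- Almost decrease after division by `tⁿ`, compared at `r` and `2r`, costs only a factor `2ⁿ`. This
allows the return from the doubled ball to the original one. -/
lemma GClass.exists_doubling (hφ : GClass n Φ φ) :
    ∃ C : ℝ≥0∞, C ≠ ∞ ∧ ∀ r : ℝ≥0, 0 < r →
      (φ (2 * r) : ℝ≥0∞) / invScale n Φ (2 * r) ≤ C * (φ r / invScale n Φ r) := by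
  obtain ⟨C, hC, h⟩ := hφ.almostDecreasing
  have hC0 : (C : ℝ≥0∞) ≠ 0 := by exact_mod_cast hC.ne'
  refine ⟨(C : ℝ≥0∞)⁻¹ * 2 ^ n, by finiteness, fun r hr => ?_⟩
  have h1 := h r (2 * r) hr (le_mul_of_one_le_left zero_le one_le_two)
  have hpow : ∀ t : ℝ≥0, 0 < t → ∀ a : ℝ≥0∞,
      (φ t : ℝ≥0∞) / (a * (t : ℝ≥0∞) ^ n) = φ t / a * ((t : ℝ≥0∞) ^ n)⁻¹ := fun t ht a => by
    simp only [div_eq_mul_inv]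
    rw [ENNReal.mul_inv (Or.inr (by simp [ENNReal.pow_eq_top_iff])) (Or.inr (by simp [ht.ne'])),
      mul_assoc]
  have h2r : (0 : ℝ≥0) < 2 * r := by positivity
  simp only [hpow _ hr, hpow _ h2r] at h1
  have hr0 : ((2 * r : ℝ≥0) : ℝ≥0∞) ^ n ≠ 0 := by simp [hr.ne']
  have hr1 : ((2 * r : ℝ≥0) : ℝ≥0∞) ^ n ≠ ∞ := ENNReal.pow_ne_top ENNReal.coe_ne_top
  rw [← mul_assoc, ← div_eq_mul_inv _ (((2 * r : ℝ≥0) : ℝ≥0∞) ^ n), ENNReal.div_le_iff hr0 hr1,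
    mul_comm (C : ℝ≥0∞), ← ENNReal.le_div_iff_mul_le (Or.inl hC0) (Or.inl ENNReal.coe_ne_top)]
    at h1
  refine h1.trans_eq ?_
  have hr2 : (r : ℝ≥0∞) ^ n ≠ 0 := by simp [hr.ne']
  rw [ENNReal.coe_mul, mul_pow, ENNReal.coe_ofNat, div_eq_mul_inv _ (C : ℝ≥0∞)]
  calc (φ r : ℝ≥0∞) / invScale n Φ r * ((r : ℝ≥0∞) ^ n)⁻¹ * (2 ^ n * (r : ℝ≥0∞) ^ n) *
        (C : ℝ≥0∞)⁻¹
      = (((r : ℝ≥0∞) ^ n)⁻¹ * (r : ℝ≥0∞) ^ n) *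
        ((C : ℝ≥0∞)⁻¹ * 2 ^ n * (φ r / invScale n Φ r)) := by ring
    _ = _ := by rw [ENNReal.inv_mul_cancel hr2 (by finiteness), one_mul]

lemma inv_mul_mul_le_iff (hΦ : IsYoung Φ) (hφ : ∀ r, 0 < r → 0 < φ r) {r : ℝ≥0} (hr : 0 < r)
    {a b : ℝ≥0∞} :
    (φ r : ℝ≥0∞)⁻¹ * invScale n Φ r * a ≤ b ↔ a ≤ φ r / invScale n Φ r * b := by
  have hI := hΦ.invScale_ne_zero (n := n) r
  have hI' := hΦ.invScale_ne_top (n := n) hr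
  have h0 : (φ r : ℝ≥0∞) ≠ 0 := by exact_mod_cast (hφ r hr).ne'
  have h : (φ r : ℝ≥0∞)⁻¹ * invScale n Φ r = (φ r / invScale n Φ r)⁻¹ := by
    rw [div_eq_mul_inv, ENNReal.mul_inv (Or.inl h0) (Or.inl ENNReal.coe_ne_top), inv_inv]
  rw [h, ENNReal.inv_mul_le_iff (ENNReal.div_ne_zero.2 ⟨h0, hI'⟩)
    (ENNReal.div_ne_top ENNReal.coe_ne_top hI)]

section

variable {ε : Type*} [TopologicalSpace ε] [ESeminormedAddMonoid ε]

lemma luxNorm_ball_le_morreyNorm (hΦ : IsYoung Φ) (hφ : ∀ r, 0 < r → 0 < φ r)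
    (f : EuclideanSpace ℝ (Fin n) → ε) (x : EuclideanSpace ℝ (Fin n)) {r : ℝ≥0} (hr : 0 < r) :
    luxNorm Φ ((Metric.ball x (r : ℝ)).indicator f) ≤
      φ r / invScale n Φ r * morreyNorm Φ φ f :=
  (inv_mul_mul_le_iff hΦ hφ hr).1
    (le_iSup_of_le x (le_iSup₂_of_le (f := fun (r : ℝ≥0) (_ : 0 < r) => (φ r : ℝ≥0∞)⁻¹ *
      invScale n Φ r * luxNorm Φ ((Metric.ball x (r : ℝ)).indicator f)) r hr le_rfl))

lemma weakLuxNorm_ball_le_weakMorreyNorm (hΦ : IsYoung Φ) (hφ : ∀ r, 0 < r → 0 < φ r)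
    (f : EuclideanSpace ℝ (Fin n) → ε) (x : EuclideanSpace ℝ (Fin n)) {r : ℝ≥0} (hr : 0 < r) :
    weakLuxNorm Φ ((Metric.ball x (r : ℝ)).indicator f) ≤
      φ r / invScale n Φ r * weakMorreyNorm Φ φ f :=
  (inv_mul_mul_le_iff hΦ hφ hr).1
    (le_iSup_of_le x (le_iSup₂_of_le (f := fun (r : ℝ≥0) (_ : 0 < r) => (φ r : ℝ≥0∞)⁻¹ *
      invScale n Φ r * weakLuxNorm Φ ((Metric.ball x (r : ℝ)).indicator f)) r hr le_rfl))

lemma weakMorreyNorm_le_morreyNorm (hΦ : IsYoung Φ) (f : EuclideanSpace ℝ (Fin n) → ε) :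
    weakMorreyNorm Φ φ f ≤ morreyNorm Φ φ f :=
  iSup_mono fun _ => iSup₂_mono fun _ _ => mul_le_mul_right (hΦ.weakLuxNorm_le_luxNorm _) _

/-- A finite norm already forces the local conditions: local integrability by the embedding of `L^Φ`
into `L¹` on balls, finite modular with `k = 1 / L` for `L` above the local norm. -/
lemma memMorrey_of_morreyNorm_lt_top (hΦ : IsYoung Φ) (hφ : ∀ r, 0 < r → 0 < φ r)
    {f : EuclideanSpace ℝ (Fin n) → ε} (hf : AEStronglyMeasurable f volume)
    (h : morreyNorm Φ φ f < ∞) : MemMorrey Φ φ f where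
  aestronglyMeasurable := hf
  norm_lt_top := h
  memLoc x r hr := by
    have hI := hΦ.invScale_ne_zero (n := n) r
    have hI' := hΦ.invScale_ne_top (n := n) hr
    have hlux : luxNorm Φ ((Metric.ball x (r : ℝ)).indicator f) < ∞ :=
      (luxNorm_ball_le_morreyNorm hΦ hφ f x hr).trans_lt
        (ENNReal.mul_lt_top (ENNReal.div_lt_top ENNReal.coe_ne_top hI) h)
    constructor
    · refine Integrable.locallyIntegrable
        ⟨hf.indicator Metric.isOpen_ball.measurableSet, ?_⟩
      have h1 := hΦ.setLIntegral_ball_le_luxNorm (fun y => ‖f y‖ₑ) x hr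
      have h2 : luxNorm Φ ((Metric.ball x (r : ℝ)).indicator fun y => ‖f y‖ₑ) =
          luxNorm Φ ((Metric.ball x (r : ℝ)).indicator f) := by
        rw [← luxNorm_enorm ((Metric.ball x (r : ℝ)).indicator f)]
        simp only [enorm_indicator_eq_indicator_enorm]
      rw [h2] at h1
      rw [hasFiniteIntegral_iff_enorm]
      simp only [enorm_indicator_eq_indicator_enorm]
      rw [lintegral_indicator Metric.isOpen_ball.measurableSet]
      refine h1.trans_lt ?_
      have := volConst_ne_top (n := n)
      have hv : volume (Metric.ball x (r : ℝ)) ≠ ∞ := measure_ball_lt_top.ne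
      finiteness
    · obtain ⟨L, hL, _⟩ := ENNReal.lt_iff_exists_nnreal_btwn.1 hlux
      have hL0 : 0 < L := by exact_mod_cast (zero_le.trans_lt hL)
      refine ⟨L⁻¹, inv_pos.2 hL0, ?_⟩
      have h1 := hΦ.lintegral_le_one_of_luxNorm_lt hL
      simp only [ENNReal.div_eq_inv_mul] at h1
      rw [ENNReal.coe_inv hL0.ne']
      exact h1.trans_lt ENNReal.one_lt_top

lemma memWeakMorrey_of_weakMorreyNorm_lt_top (hΦ : IsYoung Φ) (hφ : ∀ r, 0 < r → 0 < φ r)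
    {f : EuclideanSpace ℝ (Fin n) → ε} (hf : AEStronglyMeasurable f volume)
    (h : weakMorreyNorm Φ φ f < ∞) : MemWeakMorrey Φ φ f where
  aestronglyMeasurable := hf
  norm_lt_top := h
  memLoc x r hr := ⟨hf.indicator Metric.isOpen_ball.measurableSet,
    (weakLuxNorm_ball_le_weakMorreyNorm hΦ hφ f x hr).trans_lt (ENNReal.mul_lt_top
      (ENNReal.div_lt_top ENNReal.coe_ne_top (hΦ.invScale_ne_zero r)) h)⟩

end

/-! ### Sufficiency -/

/-- On a ball of radius `r`, the averages over balls of radius larger than `r` are controlled by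
the Morrey norm. -/
lemma fracMaximal_ball_le_max (hΦ : IsYoung Φ) (hφ₁ : ∀ r, 0 < r → 0 < φ₁ r) {C : ℝ≥0}
    {r : ℝ≥0} (hC : ∀ t, r < t → φ₁ t * ρ t ≤ C * φ₂ r)
    (f : EuclideanSpace ℝ (Fin n) → ℝ≥0∞) {x y : EuclideanSpace ℝ (Fin n)}
    (hy : y ∈ Metric.ball x (r : ℝ)) :
    fracMaximal ρ f y ≤ max
      (fracMaximal ρ ((Metric.ball x ((2 * r : ℝ≥0) : ℝ)).indicator f) y)
      (2 * volConst n * (C * φ₂ r) * morreyNorm Φ φ₁ f) := by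
  refine fracMaximal_le_iff.2 fun t ht => ?_
  rcases le_or_gt t r with htr | htr
  · refine le_max_of_le_left (le_trans (le_of_eq ?_) (le_fracMaximal ρ _ y ht))
    congr 1
    refine setLIntegral_congr_fun Metric.isOpen_ball.measurableSet fun z hz => ?_
    have hsub : Metric.ball y (t : ℝ) ⊆ Metric.ball x ((2 * r : ℝ≥0) : ℝ) := by
      refine Metric.ball_subset_ball' ?_
      have h1 := Metric.mem_ball.1 hy
      have h2 : (t : ℝ) ≤ r := by exact_mod_cast htr
      push_cast
      linarith
    exact (indicator_of_mem (hsub hz) f).symm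
  · refine le_max_of_le_right ?_
    have hI := hΦ.invScale_ne_zero (n := n) t
    have hI' := hΦ.invScale_ne_top (n := n) ht
    have h0 := volume_ball_ne_zero y ht
    have h1 : volume (Metric.ball y (t : ℝ)) ≠ ∞ := measure_ball_lt_top.ne
    calc ρ t / volume (Metric.ball y (t : ℝ)) * ∫⁻ z in Metric.ball y (t : ℝ), f z
        ≤ ρ t / volume (Metric.ball y (t : ℝ)) *
          (2 * (volConst n * invScale n Φ t) * volume (Metric.ball y (t : ℝ)) *
            (φ₁ t / invScale n Φ t * morreyNorm Φ φ₁ f)) := by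
          gcongr
          refine (hΦ.setLIntegral_ball_le_luxNorm f y ht).trans ?_
          gcongr
          exact luxNorm_ball_le_morreyNorm hΦ hφ₁ f y ht
      -- The factor `Φ⁻¹(t⁻ⁿ)` from the `L¹` embedding cancels the one in the Morrey norm, leaving
      -- exactly `φ₁(t) ρ(t)`.
      _ = (ρ t / volume (Metric.ball y (t : ℝ)) * volume (Metric.ball y (t : ℝ))) *
          (φ₁ t / invScale n Φ t * invScale n Φ t) *
          (2 * volConst n * morreyNorm Φ φ₁ f) := by ring
      _ = (φ₁ t * ρ t : ℝ≥0) * (2 * volConst n * morreyNorm Φ φ₁ f) := by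
          rw [ENNReal.div_mul_cancel h0 h1, ENNReal.div_mul_cancel hI hI']
          push_cast; ring
      _ ≤ (C * φ₂ r : ℝ≥0) * (2 * volConst n * morreyNorm Φ φ₁ f) := by
          refine mul_le_mul_left ?_ _
          exact_mod_cast hC t htr
      _ = _ := by push_cast; ring

/-- Passage from Orlicz to Orlicz-Morrey estimates, for a quasi-norm `N` that is either strong or
weak. -/
lemma exists_local_estimate (hΦ : IsYoung Φ) (hΨ : IsYoung Ψ)
    (hφ₁ : GClass n Φ φ₁) (hφ₂ : GClass n Ψ φ₂) (hphi : PhiCondition n Φ Ψ φ₁ φ₂)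
    (hsup : SupCondition ρ φ₁ φ₂)
    (N : (EuclideanSpace ℝ (Fin n) → ℝ≥0∞) → ℝ≥0∞)
    (hN : ∀ F G H : EuclideanSpace ℝ (Fin n) → ℝ≥0∞, Measurable G →
      (∀ x, F x ≤ max (G x) (H x)) → N F ≤ 2 * (N G + N H))
    (hN' : ∀ F, N F ≤ luxNorm Ψ F) {D : ℝ≥0∞} (hD : D ≠ ∞)
    (hND : ∀ g : EuclideanSpace ℝ (Fin n) → ℝ≥0∞, AEMeasurable g →
      N (fracMaximal ρ g) ≤ D * luxNorm Φ g) :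
    ∃ C : ℝ≥0, ∀ f : EuclideanSpace ℝ (Fin n) → ℝ≥0∞, AEMeasurable f →
      ∀ (x : EuclideanSpace ℝ (Fin n)) (r : ℝ≥0), 0 < r →
        (φ₂ r : ℝ≥0∞)⁻¹ * invScale n Ψ r *
          N ((Metric.ball x (r : ℝ)).indicator (fracMaximal ρ f)) ≤
            C * morreyNorm Φ φ₁ f := by
  obtain ⟨A, hA, hdouble⟩ := hφ₂.exists_doubling
  obtain ⟨P, hP⟩ := hphi
  obtain ⟨S, hS⟩ := hsup
  have hκ := volConst_ne_zero (n := n)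
  have hκ' := volConst_ne_top (n := n)
  -- The outer `2` comes from the quasi-triangle inequality. `D`, `P`, `A` are the Orlicz bound, (b)
  -- at radius `2r` and doubling; the other summand is the norm on the ball of the constant bounding
  -- large radii. `S + 1` keeps `Q` nonzero.
  set Q : ℝ≥0∞ := 2 * (D * (P * A) + 2 * volConst n * (2 * volConst n * ((S + 1 : ℝ≥0) : ℝ≥0∞)))
    with hQ
  have hQ' : Q ≠ ∞ := by rw [hQ]; finiteness
  have hQ0 : Q ≠ 0 := by simp [hQ, hκ]
  refine ⟨Q.toNNReal, fun f hf x r hr => ?_⟩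
  rw [ENNReal.coe_toNNReal hQ']
  refine le_mul_of_forall_lt hQ0 hQ' fun L hL => ?_
  have hL0 : (L : ℝ≥0∞) ≠ 0 := (zero_le.trans_lt hL).ne'
  rw [inv_mul_mul_le_iff hΨ hφ₂.pos hr]
  have h2r : (0 : ℝ≥0) < 2 * r := by positivity
  have hbd : ∀ t, r < t → φ₁ t * ρ t ≤ (S + 1) * φ₂ r := fun t ht => by
    have h1 := (iSup₂_le_iff.1 (hS r hr)) t ht
    rw [ENNReal.coe_le_coe] at h1
    refine h1.trans ?_
    gcongr
    exact le_self_add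
  -- Using `L` in place of the Morrey norm makes `c` positive and finite, as the norm bound for
  -- constants requires.
  set c : ℝ≥0∞ := 2 * volConst n * (((S + 1 : ℝ≥0) : ℝ≥0∞) * φ₂ r) * L with hc
  have hc0 : c ≠ 0 := by
    have := hφ₂.coe_ne_zero hr
    simp [hc, hκ, this]
    exact_mod_cast hL0
  have hc' : c ≠ ∞ := by rw [hc]; finiteness
  calc N ((Metric.ball x (r : ℝ)).indicator (fracMaximal ρ f))
      ≤ 2 * (N (fracMaximal ρ ((Metric.ball x ((2 * r : ℝ≥0) : ℝ)).indicator f)) +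
          N ((Metric.ball x (r : ℝ)).indicator fun _ => c)) := by
        refine hN _ _ _ (measurable_fracMaximal _ _) fun y => ?_
        by_cases hy : y ∈ Metric.ball x (r : ℝ)
        · rw [indicator_of_mem hy, indicator_of_mem hy]
          refine (fracMaximal_ball_le_max hΦ hφ₁.pos hbd f hy).trans ?_
          rw [hc]
          gcongr
        · rw [indicator_of_notMem hy]; exact zero_le
    _ ≤ 2 * (D * (P * A) * (φ₂ r / invScale n Ψ r * L) +
          2 * volConst n * c / invScale n Ψ r) := by
        gcongr
        · refine (hND _ (hf.indicator Metric.isOpen_ball.measurableSet)).trans ?_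
          rw [mul_assoc]
          gcongr
          refine (luxNorm_ball_le_morreyNorm hΦ hφ₁.pos f x h2r).trans ?_
          calc (φ₁ (2 * r) : ℝ≥0∞) / invScale n Φ (2 * r) * morreyNorm Φ φ₁ f
              ≤ P * (A * (φ₂ r / invScale n Ψ r)) * L := by
                gcongr
                exact (hP _ h2r).trans (mul_le_mul_right (hdouble r hr) _)
            _ = _ := by ring
        · exact (hN' _).trans (hΨ.luxNorm_ball_const_le x hr hc0 hc')
    _ = φ₂ r / invScale n Ψ r * (Q * L) := by
        rw [hQ, hc]
        simp only [div_eq_mul_inv]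
        ring

lemma weakBounded_of_supCondition (hn : 0 < n) (𝕜 : Type*) [RCLike 𝕜] (hΦ : IsYoung Φ)
    (hΨ : IsYoung Ψ) (hφ₁ : GClass n Φ φ₁) (hφ₂ : GClass n Ψ φ₂) (hρ : MonotoneOn ρ (Ioi 0))
    (hrho : RhoCondition n ρ Φ Ψ) (hphi : PhiCondition n Φ Ψ φ₁ φ₂)
    (hsup : SupCondition ρ φ₁ φ₂) : WeakBounded n 𝕜 ρ Φ φ₁ Ψ φ₂ := by
  obtain ⟨R, hR⟩ := hrho
  have hR' : ∀ r : ℝ≥0, 0 < r → (ρ r : ℝ≥0∞) ≤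
      ((R + 1 : ℝ≥0) : ℝ≥0∞) * (invScale n Ψ r / invScale n Φ r) := fun r hr =>
    (hR r hr).trans (by gcongr; exact le_self_add)
  have hκ := volConst_ne_top (n := n)
  obtain ⟨C, hC⟩ := exists_local_estimate hΦ hΨ hφ₁ hφ₂ hphi hsup (weakLuxNorm Ψ)
    (fun F G H hG h => hΨ.weakLuxNorm_le_of_le_max hG h) hΨ.weakLuxNorm_le_luxNorm
    (D := 5 ^ n * (2 * volConst n * ((R + 1 : ℝ≥0) : ℝ≥0∞))) (by finiteness)
    (fun g _ => weakLuxNorm_fracMaximal_le hn hΦ hΨ hρ (by simp) ENNReal.coe_ne_top hR' g)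
  refine ⟨C, fun f hf => ?_⟩
  have hle : weakMorreyNorm Ψ φ₂ (fracMaximal ρ f) ≤ C * morreyNorm Φ φ₁ f := by
    rw [fracMaximal_enorm, ← morreyNorm_enorm]
    exact iSup_le fun x => iSup₂_le fun r hr => hC _ hf.aestronglyMeasurable.enorm x r hr
  refine ⟨memWeakMorrey_of_weakMorreyNorm_lt_top hΨ hφ₂.pos ?_
    (hle.trans_lt (ENNReal.mul_lt_top ENNReal.coe_lt_top hf.norm_lt_top)), hle⟩
  rw [fracMaximal_enorm]
  exact (measurable_fracMaximal _ _).aestronglyMeasurable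

lemma strongBounded_of_supCondition (hn : 0 < n) (𝕜 : Type*) [RCLike 𝕜] (hΦ : IsYoung Φ)
    (hΨ : IsYoung Ψ) (hφ₁ : GClass n Φ φ₁) (hφ₂ : GClass n Ψ φ₂) (hρ : MonotoneOn ρ (Ioi 0))
    (hrho : RhoCondition n ρ Φ Ψ) (hphi : PhiCondition n Φ Ψ φ₁ φ₂)
    (hnabla : Nabla2 Φ) (hsup : SupCondition ρ φ₁ φ₂) : StrongBounded n 𝕜 ρ Φ φ₁ Ψ φ₂ := by
  obtain ⟨R, hR⟩ := hrho
  have hR' : ∀ r : ℝ≥0, 0 < r → (ρ r : ℝ≥0∞) ≤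
      ((R + 1 : ℝ≥0) : ℝ≥0∞) * (invScale n Ψ r / invScale n Φ r) := fun r hr =>
    (hR r hr).trans (by gcongr; exact le_self_add)
  obtain ⟨D, hD, hDg⟩ :=
    exists_luxNorm_fracMaximal_le hn hΦ hΨ hρ (by simp) ENNReal.coe_ne_top hR' hnabla
  obtain ⟨C, hC⟩ := exists_local_estimate hΦ hΨ hφ₁ hφ₂ hphi hsup (luxNorm Ψ)
    (fun F G H hG h => hΨ.luxNorm_le_of_le_max hG h) (fun _ => le_rfl) hD hDg
  refine ⟨C, fun f hf => ?_⟩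
  have hle : morreyNorm Ψ φ₂ (fracMaximal ρ f) ≤ C * morreyNorm Φ φ₁ f := by
    rw [fracMaximal_enorm, ← morreyNorm_enorm φ₁ f]
    exact iSup_le fun x => iSup₂_le fun r hr => hC _ hf.aestronglyMeasurable.enorm x r hr
  refine ⟨memMorrey_of_morreyNorm_lt_top hΨ hφ₂.pos ?_
    (hle.trans_lt (ENNReal.mul_lt_top ENNReal.coe_lt_top hf.norm_lt_top)), hle⟩
  rw [fracMaximal_enorm]
  exact (measurable_fracMaximal _ _).aestronglyMeasurable

/-! ### Necessity -/

lemma StrongBounded.weakBounded {𝕜 : Type*} [RCLike 𝕜] (hΨ : IsYoung Ψ)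
    (hφ₂ : ∀ r, 0 < r → 0 < φ₂ r)
    (h : StrongBounded n 𝕜 ρ Φ φ₁ Ψ φ₂) : WeakBounded n 𝕜 ρ Φ φ₁ Ψ φ₂ := by
  obtain ⟨C, hC⟩ := h
  refine ⟨C, fun f hf => ?_⟩
  obtain ⟨hmem, hle⟩ := hC f hf
  have h1 := weakMorreyNorm_le_morreyNorm (φ := φ₂) hΨ (fracMaximal ρ f)
  exact ⟨memWeakMorrey_of_weakMorreyNorm_lt_top hΨ hφ₂ hmem.aestronglyMeasurable
    (h1.trans_lt hmem.norm_lt_top), h1.trans hle⟩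

/-- Test balls of radius `t ≤ r` give at most a multiple of `1 / φ₁(t)`, controlled by almost
decrease of `φ₁`. For `t ≥ r` the local norm is at most that of the whole indicator, and almost
increase of `φ₁ / Φ⁻¹(·⁻ⁿ)` applies. -/
lemma exists_morreyNorm_ball_le (𝕜 : Type*) [RCLike 𝕜] (hΦ : IsYoung Φ) (hφ₁ : GClass n Φ φ₁)
    (hdec : AlmostDecreasing fun t => (φ₁ t : ℝ≥0∞)) :
    ∃ D : ℝ≥0∞, D ≠ ∞ ∧ ∀ r : ℝ≥0, 0 < r →
      morreyNorm Φ φ₁ ((Metric.ball (0 : EuclideanSpace ℝ (Fin n)) (r : ℝ)).indicator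
        fun _ => (1 : 𝕜)) ≤ D * (φ₁ r : ℝ≥0∞)⁻¹ := by
  obtain ⟨C, hC, hdec⟩ := hdec
  obtain ⟨C', hC', hinc⟩ := hφ₁.almostIncreasing
  have hC0 : (C : ℝ≥0∞) ≠ 0 := by exact_mod_cast hC.ne'
  have hκ := volConst_ne_top (n := n)
  refine ⟨2 * volConst n * ((C : ℝ≥0∞)⁻¹ + C'), by finiteness, fun r hr => ?_⟩
  have h0 := hφ₁.coe_ne_zero hr
  refine iSup_le fun x => iSup₂_le fun t ht => ?_
  rw [inv_mul_mul_le_iff hΦ hφ₁.pos ht]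
  have hlux : ∀ (z : EuclideanSpace ℝ (Fin n)) (s : ℝ≥0), 0 < s →
      (∀ y, y ∈ Metric.ball x (t : ℝ) → y ∈ Metric.ball (0 : EuclideanSpace ℝ (Fin n)) (r : ℝ) →
        y ∈ Metric.ball z (s : ℝ)) →
      luxNorm Φ ((Metric.ball x (t : ℝ)).indicator
        ((Metric.ball (0 : EuclideanSpace ℝ (Fin n)) (r : ℝ)).indicator fun _ => (1 : 𝕜))) ≤
      2 * volConst n / invScale n Φ s := by
    intro z s hs hz
    have h1 := hΦ.luxNorm_ball_const_le z hs one_ne_zero ENNReal.one_ne_top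
    rw [mul_one] at h1
    refine (hΦ.luxNorm_mono fun y => ?_).trans h1
    by_cases hy : y ∈ Metric.ball x (t : ℝ)
    · by_cases hy' : y ∈ Metric.ball (0 : EuclideanSpace ℝ (Fin n)) (r : ℝ)
      · rw [indicator_of_mem hy, indicator_of_mem hy', indicator_of_mem (hz y hy hy')]
        simp
      · rw [indicator_of_mem hy, indicator_of_notMem hy']; simp
    · rw [indicator_of_notMem hy]; simp
  have hcancel : (φ₁ r : ℝ≥0∞) * (φ₁ r : ℝ≥0∞)⁻¹ = 1 :=
    ENNReal.mul_inv_cancel h0 ENNReal.coe_ne_top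
  rcases le_total t r with htr | htr
  · refine (hlux x t ht fun y hy _ => hy).trans ?_
    have h1 : (1 : ℝ≥0∞) ≤ φ₁ t * ((C : ℝ≥0∞)⁻¹ * (φ₁ r : ℝ≥0∞)⁻¹) := by
      calc (1 : ℝ≥0∞) = C * φ₁ r * ((C : ℝ≥0∞)⁻¹ * (φ₁ r : ℝ≥0∞)⁻¹) := by
            rw [mul_mul_mul_comm, ENNReal.mul_inv_cancel hC0 ENNReal.coe_ne_top, hcancel, one_mul]
        _ ≤ _ := by gcongr; exact hdec t r ht htr
    calc 2 * volConst n / invScale n Φ t = 2 * volConst n / invScale n Φ t * 1 := (mul_one _).symm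
      _ ≤ 2 * volConst n / invScale n Φ t *
          (φ₁ t * (((C : ℝ≥0∞)⁻¹ + C') * (φ₁ r : ℝ≥0∞)⁻¹)) := by
          gcongr
          refine h1.trans ?_
          gcongr
          exact le_self_add
      _ = _ := by simp only [div_eq_mul_inv]; ring
  · refine (hlux 0 r hr fun y _ hy => hy).trans ?_
    calc 2 * volConst n / invScale n Φ r
        = 2 * volConst n * (φ₁ r / invScale n Φ r) * (φ₁ r : ℝ≥0∞)⁻¹ := by
          simp only [div_eq_mul_inv]
          calc 2 * volConst n * (invScale n Φ r)⁻¹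
              = 2 * volConst n * (invScale n Φ r)⁻¹ * ((φ₁ r : ℝ≥0∞) * (φ₁ r : ℝ≥0∞)⁻¹) := by
                rw [hcancel, mul_one]
            _ = _ := by ring
      _ ≤ 2 * volConst n * (C' * (φ₁ t / invScale n Φ t)) * (φ₁ r : ℝ≥0∞)⁻¹ := by
          gcongr 2 * volConst n * ?_ * _
          exact hinc r t hr htr
      _ ≤ 2 * volConst n * (((C : ℝ≥0∞)⁻¹ + C') * (φ₁ t / invScale n Φ t)) *
          (φ₁ r : ℝ≥0∞)⁻¹ := by
          gcongr
          exact le_add_self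
      _ = _ := by ring

/-- The ball of radius `r / 2` about `x / 2` lies in both `B(x,r)` and `B(0,r)`, and fills the
fraction `2⁻ⁿ` of the volume of `B(x,r)`. -/
lemma le_fracMaximal_indicator_ball (𝕜 : Type*) [RCLike 𝕜] {r : ℝ≥0} (hr : 0 < r)
    {x : EuclideanSpace ℝ (Fin n)} (hx : x ∈ Metric.ball 0 (r : ℝ)) :
    (2 ^ n)⁻¹ * (ρ r : ℝ≥0∞) ≤ fracMaximal ρ
      ((Metric.ball (0 : EuclideanSpace ℝ (Fin n)) (r : ℝ)).indicator fun _ => (1 : 𝕜)) x := by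
  rw [fracMaximal_enorm]
  refine le_trans ?_ (le_fracMaximal ρ _ x hr)
  have hx' : ‖x‖ < r := by simpa using hx
  set z : EuclideanSpace ℝ (Fin n) := (2⁻¹ : ℝ) • x with hz
  have hzn : ‖z‖ = ‖x‖ / 2 := by rw [hz, norm_smul]; norm_num; ring
  have hxz : ‖z - x‖ = ‖x‖ / 2 := by
    have : z - x = (-2⁻¹ : ℝ) • x := by rw [hz]; module
    rw [this, norm_smul]; norm_num; ring
  have h1 : Metric.ball z ((r / 2 : ℝ≥0) : ℝ) ⊆ Metric.ball x (r : ℝ) := by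
    refine Metric.ball_subset_ball' ?_
    rw [dist_eq_norm, hxz]; push_cast; linarith
  have h2 : Metric.ball z ((r / 2 : ℝ≥0) : ℝ) ⊆ Metric.ball 0 (r : ℝ) := by
    refine Metric.ball_subset_ball' ?_
    rw [dist_zero_right, hzn]; push_cast; linarith
  have h3 : volume (Metric.ball z ((r / 2 : ℝ≥0) : ℝ)) ≤ ∫⁻ y in Metric.ball x (r : ℝ),
      ‖(Metric.ball (0 : EuclideanSpace ℝ (Fin n)) (r : ℝ)).indicator (fun _ => (1 : 𝕜)) y‖ₑ := by
    refine le_trans ?_ (lintegral_mono_set h1)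
    rw [← setLIntegral_one]
    refine setLIntegral_mono' Metric.isOpen_ball.measurableSet fun y hy => ?_
    rw [indicator_of_mem (h2 hy)]
    simp
  have h4 : volume (Metric.ball z ((r / 2 : ℝ≥0) : ℝ)) =
      (2 ^ n)⁻¹ * volume (Metric.ball x (r : ℝ)) := by
    rw [volume_ball_nnreal z (half_pos hr), volume_ball_nnreal x hr, ENNReal.coe_div two_ne_zero,
      div_eq_mul_inv, mul_pow, ENNReal.coe_ofNat, ENNReal.inv_pow]
    ring
  calc (2 ^ n)⁻¹ * (ρ r : ℝ≥0∞)
      = ρ r / volume (Metric.ball x (r : ℝ)) * volume (Metric.ball z ((r / 2 : ℝ≥0) : ℝ)) := by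
        rw [h4, mul_left_comm,
          ENNReal.div_mul_cancel (volume_ball_ne_zero x hr) measure_ball_lt_top.ne]
    _ ≤ _ := by gcongr

lemma WeakBounded.pointCondition {𝕜 : Type*} [RCLike 𝕜] (hΦ : IsYoung Φ) (hΨ : IsYoung Ψ)
    (hφ₁ : GClass n Φ φ₁) (hφ₂ : ∀ r, 0 < r → 0 < φ₂ r) (hρ : ∀ r, 0 < r → 0 < ρ r)
    (hdec : AlmostDecreasing fun t => (φ₁ t : ℝ≥0∞)) (h : WeakBounded n 𝕜 ρ Φ φ₁ Ψ φ₂) :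
    PointCondition ρ φ₁ φ₂ := by
  obtain ⟨C, hC⟩ := h
  obtain ⟨D, hD, hDr⟩ := exists_morreyNorm_ball_le 𝕜 hΦ hφ₁ hdec
  have hκ := volConst_ne_top (n := n)
  have hQ : (2 ^ n * 2 * volConst n * (C * D) : ℝ≥0∞) ≠ ∞ := by finiteness
  refine ⟨(2 ^ n * 2 * volConst n * (C * D) : ℝ≥0∞).toNNReal, fun r hr => ?_⟩
  have h0 := hφ₁.coe_ne_zero hr
  set f : EuclideanSpace ℝ (Fin n) → 𝕜 :=
    (Metric.ball (0 : EuclideanSpace ℝ (Fin n)) (r : ℝ)).indicator fun _ => (1 : 𝕜) with hf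
  have hfm : morreyNorm Φ φ₁ f < ∞ := (hDr r hr).trans_lt (by finiteness)
  obtain ⟨-, hle⟩ := hC f (memMorrey_of_morreyNorm_lt_top hΦ hφ₁.pos
    (aestronglyMeasurable_const.indicator Metric.isOpen_ball.measurableSet) hfm)
  -- Half the lower bound for `M_ρ f`, so that the whole ball lies in the strict superlevel set at
  -- `c`.
  set c : ℝ≥0 := (2 ^ n)⁻¹ * ρ r / 2 with hc
  have hc0 : 0 < c := by have := hρ r hr; positivity
  have hclt : (c : ℝ≥0∞) < (2 ^ n)⁻¹ * (ρ r : ℝ≥0∞) := by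
    have h1 : c < (2 ^ n)⁻¹ * ρ r := by
      have := hρ r hr
      exact half_lt_self (by positivity)
    have h2 : (c : ℝ≥0∞) < (((2 ^ n)⁻¹ * ρ r : ℝ≥0) : ℝ≥0∞) := by exact_mod_cast h1
    rwa [ENNReal.coe_mul, ENNReal.coe_inv (by positivity), ENNReal.coe_pow, ENNReal.coe_ofNat]
      at h2
  have hI := hΨ.invScale_ne_zero (n := n) r
  have hI' := hΨ.invScale_ne_top (n := n) hr
  have hcle : (c : ℝ≥0∞) ≤ volConst n * φ₂ r * (C * (D * (φ₁ r : ℝ≥0∞)⁻¹)) := by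
    calc (c : ℝ≥0∞) ≤ volConst n * invScale n Ψ r * luxNorm Ψ
          ((Metric.ball (0 : EuclideanSpace ℝ (Fin n)) (r : ℝ)).indicator fun _ => (c : ℝ≥0∞)) :=
          hΨ.le_luxNorm_ball_const 0 hr c
      _ ≤ volConst n * invScale n Ψ r * weakLuxNorm Ψ
          ((Metric.ball (0 : EuclideanSpace ℝ (Fin n)) (r : ℝ)).indicator (fracMaximal ρ f)) := by
          gcongr
          refine le_iSup₂_of_le c hc0 (hΨ.luxNorm_mono fun y => ?_)
          by_cases hy : y ∈ Metric.ball (0 : EuclideanSpace ℝ (Fin n)) (r : ℝ)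
          · rw [indicator_of_mem hy, indicator_of_mem]
            rw [mem_ofPred_eq, indicator_of_mem hy, enorm_eq_self]
            exact hclt.trans_le (le_fracMaximal_indicator_ball 𝕜 hr hy)
          · rw [indicator_of_notMem hy]; simp
      _ ≤ volConst n * invScale n Ψ r *
          (φ₂ r / invScale n Ψ r * (C * (D * (φ₁ r : ℝ≥0∞)⁻¹))) := by
          gcongr
          refine (weakLuxNorm_ball_le_weakMorreyNorm hΨ hφ₂ _ 0 hr).trans ?_
          gcongr
          refine hle.trans ?_
          gcongr
          exact hDr r hr
      _ = (φ₂ r / invScale n Ψ r * invScale n Ψ r) *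
          (volConst n * (C * (D * (φ₁ r : ℝ≥0∞)⁻¹))) := by ring
      _ = _ := by rw [ENNReal.div_mul_cancel hI hI']; ring
  have hρc : ρ r = 2 ^ n * 2 * c := by
    rw [hc]; field_simp
  rw [← ENNReal.coe_le_coe, ENNReal.coe_mul, ENNReal.coe_mul, ENNReal.coe_toNNReal hQ, hρc]
  push_cast
  calc (φ₁ r : ℝ≥0∞) * (2 ^ n * 2 * c)
      ≤ φ₁ r * (2 ^ n * 2 * (volConst n * φ₂ r * (C * (D * (φ₁ r : ℝ≥0∞)⁻¹)))) := by gcongr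
    _ = φ₁ r * (φ₁ r : ℝ≥0∞)⁻¹ * (2 ^ n * 2 * volConst n * (C * D) * φ₂ r) := by ring
    _ = _ := by rw [ENNReal.mul_inv_cancel h0 ENNReal.coe_ne_top, one_mul]

/-- For `t > r`, (d) at `t` gives a multiple of `φ₂(t)`, which almost decrease brings back to
`φ₂(r)`. -/
lemma PointCondition.supCondition (h : PointCondition ρ φ₁ φ₂)
    (hdec : AlmostDecreasing fun t => (φ₂ t : ℝ≥0∞)) : SupCondition ρ φ₁ φ₂ := by
  obtain ⟨C, hC⟩ := h
  obtain ⟨A, hA, hdec⟩ := hdec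
  refine ⟨C * A⁻¹, fun r hr => iSup₂_le fun t ht => ?_⟩
  rw [ENNReal.coe_le_coe]
  have h1 : A * φ₂ t ≤ φ₂ r := by
    have := hdec r t hr ht.le
    beta_reduce at this
    exact_mod_cast this
  calc φ₁ t * ρ t ≤ C * φ₂ t := hC t (hr.trans ht)
    _ = C * (A⁻¹ * (A * φ₂ t)) := by rw [inv_mul_cancel_left₀ hA.ne']
    _ ≤ C * (A⁻¹ * φ₂ r) := by gcongr
    _ = _ := (mul_assoc _ _ _).symm

end OrliczMorrey

end

theorem mainTheorem5 (n : ℕ) (hn : 0 < n) (𝕜 : Type*) [RCLike 𝕜]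
    (Φ Ψ : ℝ≥0∞ → ℝ≥0∞) (hΦ : OrliczMorrey.IsYoung Φ) (hΨ : OrliczMorrey.IsYoung Ψ)
    (φ₁ φ₂ : ℝ≥0 → ℝ≥0) (hφ₁ : OrliczMorrey.GClass n Φ φ₁) (hφ₂ : OrliczMorrey.GClass n Ψ φ₂)
    (ρ : ℝ≥0 → ℝ≥0) (hρ : ∀ r, 0 < r → 0 < ρ r) :
    -- sufficiency
    (OrliczMorrey.AdmissibleRho n ρ → OrliczMorrey.RhoCondition n ρ Φ Ψ →
      OrliczMorrey.PhiCondition n Φ Ψ φ₁ φ₂ →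
        (OrliczMorrey.SupCondition ρ φ₁ φ₂ → OrliczMorrey.WeakBounded n 𝕜 ρ Φ φ₁ Ψ φ₂) ∧
        (OrliczMorrey.Nabla2 Φ → OrliczMorrey.SupCondition ρ φ₁ φ₂ →
          OrliczMorrey.StrongBounded n 𝕜 ρ Φ φ₁ Ψ φ₂)) ∧
    -- necessity; `W𝓜^{1,φ₂}` is the weak space of the Young function `t ↦ t`
    (OrliczMorrey.AlmostDecreasing (fun t => (φ₁ t : ℝ≥0∞)) →
        (OrliczMorrey.WeakBounded n 𝕜 ρ Φ φ₁ (fun t => t) φ₂ →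
          OrliczMorrey.PointCondition ρ φ₁ φ₂) ∧
        (OrliczMorrey.StrongBounded n 𝕜 ρ Φ φ₁ Ψ φ₂ →
          OrliczMorrey.PointCondition ρ φ₁ φ₂)) ∧
    -- characterization
    (OrliczMorrey.AdmissibleRho n ρ → OrliczMorrey.RhoCondition n ρ Φ Ψ →
      OrliczMorrey.PhiCondition n Φ Ψ φ₁ φ₂ →
      OrliczMorrey.AlmostDecreasing (fun t => (φ₁ t : ℝ≥0∞)) →
      OrliczMorrey.AlmostDecreasing (fun t => (φ₂ t : ℝ≥0∞)) →
        (OrliczMorrey.PointCondition ρ φ₁ φ₂ ↔ OrliczMorrey.WeakBounded n 𝕜 ρ Φ φ₁ Ψ φ₂) ∧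
        (OrliczMorrey.Nabla2 Φ →
          (OrliczMorrey.PointCondition ρ φ₁ φ₂ ↔
            OrliczMorrey.StrongBounded n 𝕜 ρ Φ φ₁ Ψ φ₂))) := by
  refine ⟨fun hρ' hrho hphi => ⟨fun hsup => ?_, fun hnabla hsup => ?_⟩,
    fun hdec => ⟨fun h => ?_, fun h => ?_⟩,
    fun hρ' hrho hphi hdec₁ hdec₂ => ⟨⟨fun h => ?_, fun h => ?_⟩,
      fun hnabla => ⟨fun h => ?_, fun h => ?_⟩⟩⟩
  · exact OrliczMorrey.weakBounded_of_supCondition hn 𝕜 hΦ hΨ hφ₁ hφ₂ hρ'.1 hrho hphi hsup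
  · exact OrliczMorrey.strongBounded_of_supCondition hn 𝕜 hΦ hΨ hφ₁ hφ₂ hρ'.1 hrho hphi hnabla hsup
  · exact h.pointCondition hΦ OrliczMorrey.IsYoung.id hφ₁ hφ₂.pos hρ hdec
  · exact (h.weakBounded hΨ hφ₂.pos).pointCondition hΦ hΨ hφ₁ hφ₂.pos hρ hdec
  · exact OrliczMorrey.weakBounded_of_supCondition hn 𝕜 hΦ hΨ hφ₁ hφ₂ hρ'.1 hrho hphi
      (h.supCondition hdec₂)
  · exact h.pointCondition hΦ hΨ hφ₁ hφ₂.pos hρ hdec₁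
  · exact OrliczMorrey.strongBounded_of_supCondition hn 𝕜 hΦ hΨ hφ₁ hφ₂ hρ'.1 hrho hphi hnabla
      (h.supCondition hdec₂)
  · exact (h.weakBounded hΨ hφ₂.pos).pointCondition hΦ hΨ hφ₁ hφ₂.pos hρ hdec₁
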